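/- A machine is a partial computable function $U$ from binary strings to binary strings. Let $C_U(x)=\min\{|p| : U(p)=x\}$ ($\infty$ if there is no such $p$). The machine $U$ is optimal if for every machine $V$ there is $c$ with $C_U(x)\le C_V(x)+c$ for all $x$. It is effectively optimal if for every machine $V$ there are a total computable function $h$ and a constant $c$ such that $|h(x)|\le|x|+c$ for all $x$, and for all $x$ the values $V(x)$ and $U(h(x))$ are either both undefined or both defined and equal. It is left-total if for every $n$ the $n$-bit strings in $\mathrm{dom}(U)$ form an initial segment in the lexicographic order. For a set $A$ of strings let $\varkappa_n(A)$ be the fraction of strings of length at most $n$ that belong to $A$; the upper density of $A$ is $\limsup_n\varkappa_n(A)$, and $A$ has density $0$ if $\varkappa_n(A)\to0$. A randomized algorithm is an oracle machine $\Gamma$ whose oracle $X\in\{0,1\}^{\mathbb N}$ is a sequence of independent fair coin tosses; probabilities refer to $X$. A partial function $\alpha$ from strings to $\{0,1\}$ makes no errors for $A$ if $\alpha(x)=1$ implies $x\in A$ and $\alpha(x)=0$ implies $x\notin A$. For real $r$, the set $A$ is $r$-i.o.-generically probabilistically computable if there is a randomized algorithm $\Gamma$ such that with positive probability the partial function $\alpha=\Gamma^X$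 makes no errors for $A$ and, for infinitely many $n$, is defined on at least an $r$-fraction of the strings of length at most $n$. Theorem. (a) Let $U$ be an optimal machine. There is no randomized algorithm that with positive probability computes a partial function that makes no errors for $\mathrm{dom}(U)$ and whose domain has upper density $1$. (b) Whether $\mathrm{dom}(U)$ is $(1-\varepsilon)$-i.o.-generically probabilistically computable depends on the choice of the optimal machine $U$: (b1) left-total optimal machines exist, and if $U$ is optimal and left-total, then $\mathrm{dom}(U)$ is $(1-\varepsilon)$-i.o.-generically probabilistically computable for every $\varepsilon>0$; (b2) machines that are both optimal and effectively optimal exist, and for every effectively optimal $U$ there is $\varepsilon>0$ such that $\mathrm{dom}(U)$ is not $(1-\varepsilon)$-i.o.-generically probabilistically computable; (b3) for every fixed $\varepsilon$ with $0<\varepsilon<1$ there are an optimal machine $U$ for which $\mathrm{dom}(U)$ is $(1-\varepsilon)$-i.o.-generically probabilistically computable and an optimal machine $U$ for which it is not. (c) There is a computably enumerable set $S$ of strings of density $0$ such that for every randomized algorithm $\Gamma$ the probability that $\Gamma$ enumerates an infinite subset of the complement of $S$ is $0$. -/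

import Mathlib

open MeasureTheory Filter Topology

/-! ### Machines and optimality -/

/-- `complexity U x` is the minimal length of a program `p` with `U p = x`
(and `⊤` if there is no such program). -/
noncomputable def complexity (U : List Bool →. List Bool) (x : List Bool) : ℕ∞ :=
  ⨅ (p : List Bool) (_ : x ∈ U p), (p.length : ℕ∞)

/-- A machine is a partial computable function from bit strings to bit strings; it is optimal if
its complexity function is minimal up to an additive constant. -/
def IsOptimal (U : List Bool →. List Bool) : Prop :=
  Partrec U ∧ ∀ V : List Bool →. List Bool, Partrec V →
    ∃ c : ℕ, ∀ x, complexity U x ≤ complexity V x + c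

/-- `h` increases the length at most by a constant. -/
def LengthBounded (h : List Bool → List Bool) : Prop :=
  ∃ c : ℕ, ∀ x, (h x).length ≤ x.length + c

/-- Every machine `V` is reducible to `U` by a total computable length-bounded function. The
equality is between partial values: both sides are undefined, or both are defined and equal. -/
def IsEffectivelyOptimal (U : List Bool →. List Bool) : Prop :=
  Partrec U ∧ ∀ V : List Bool →. List Bool, Partrec V →
    ∃ h : List Bool → List Bool, Computable h ∧ LengthBounded h ∧ ∀ x, V x = U (h x)

/-- For every `n`, the `n`-bit strings in the domain form an initial segment in the lexicographic
ordering (`<` on `List Bool` is the lexicographic order with `false < true`). -/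
def LeftTotal (U : List Bool →. List Bool) : Prop :=
  ∀ p q : List Bool, p.length = q.length → p < q → q ∈ U.Dom → p ∈ U.Dom

/-! ### Density -/

/-- The fraction of strings of length at most `n` that belong to `A`; there are `2 ^ (n + 1) - 1`
strings of length at most `n`. -/
noncomputable def fraction (A : Set (List Bool)) (n : ℕ) : ℝ :=
  ({x : List Bool | x.length ≤ n ∧ x ∈ A}.ncard : ℝ) / ((2 : ℝ) ^ (n + 1) - 1)

noncomputable def upperDensity (A : Set (List Bool)) : ℝ :=
  limsup (fraction A) atTop

/-! ### Randomized algorithms -/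

/-- The fair coin measure on the Cantor space `ℕ → Bool`. -/
noncomputable def coinMeasure : Measure (ℕ → Bool) :=
  Measure.infinitePi fun _ : ℕ => (PMF.uniformOfFintype Bool).toMeasure

/-- The first `k` bits of `X`. -/
def bitPrefix (X : ℕ → Bool) (k : ℕ) : List Bool :=
  (List.range k).map X

/-- A randomized algorithm (an oracle machine whose oracle is the sequence of coin tosses) with
inputs in `α` and outputs in `β`. Its program is a partial computable function `next`: on input `a`,
when the bits `σ` of the oracle have been read, `next (a, σ)` is the result of the
computation up to its next interaction with the outside world. It is

* `none` if the algorithm asks for the next bit of the oracle,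
* `some b` if the algorithm halts with output `b`,
* undefined if the algorithm runs forever without asking for another bit. -/
structure RandomizedAlgorithm (α β : Type) [Primcodable α] [Primcodable β] where
  next : α × List Bool →. Option β
  partrec_next : Partrec next

namespace RandomizedAlgorithm

variable {α β : Type} [Primcodable α] [Primcodable β]

/-- The partial function computed by the algorithm with oracle `X`: the bits of `X` are supplied
one after another until the algorithm halts. The same `X` is used for all inputs. -/
def run (Γ : RandomizedAlgorithm α β) (X : ℕ → Bool) : α →. β := fun a =>
  (Nat.rfind fun k => (Γ.next (a, bitPrefix X k)).map Option.isSome).bind fun k =>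
    (Γ.next (a, bitPrefix X k)).bind fun o => (o : Part β)

theorem mem_run {Γ : RandomizedAlgorithm α β} {X : ℕ → Bool} {a : α} {b : β} :
    b ∈ Γ.run X a ↔
      ∃ k, some b ∈ Γ.next (a, bitPrefix X k) ∧
        ∀ j < k, none ∈ Γ.next (a, bitPrefix X j) := by
  simp only [run, Part.mem_bind_iff, Part.mem_coe]
  constructor
  · rintro ⟨k, hk, o, ho, rfl⟩
    refine ⟨k, ho, fun j hj => ?_⟩
    obtain ⟨o', ho', h'⟩ := (Part.mem_map_iff _).1 ((Nat.mem_rfind.1 hk).2 hj)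
    rw [Option.isSome_eq_false_iff, Option.isNone_iff_eq_none] at h'
    exact h' ▸ ho'
  · rintro ⟨k, hk, h⟩
    exact ⟨k, Nat.mem_rfind.2 ⟨(Part.mem_map_iff _).2 ⟨_, hk, rfl⟩,
      fun {j} hj => (Part.mem_map_iff _).2 ⟨_, h j hj, rfl⟩⟩, _, hk, rfl⟩

/-- The set enumerated by the algorithm with oracle `X`: all outputs on inputs `0, 1, 2, …`. -/
def enumerated (Γ : RandomizedAlgorithm ℕ (List Bool)) (X : ℕ → Bool) : Set (List Bool) :=
  {x | ∃ i, x ∈ Γ.run X i}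

end RandomizedAlgorithm

/-! ### Generic computability -/

/-- The partial `0`-`1`-valued function `f` never gives a wrong answer about membership in `A`. -/
def ErrorFree (f : List Bool →. Bool) (A : Set (List Bool)) : Prop :=
  ∀ x, (true ∈ f x → x ∈ A) ∧ (false ∈ f x → x ∉ A)

/-- `A` is `r`-i.o.-generically probabilistically computable: some randomized algorithm computes,
with positive probability, a partial function that makes no errors for `A` and that is defined,
for infinitely many `n`, on at least an `r`-fraction of the strings of length at most `n`. -/
def IOGenericallyProbComputable (r : ℝ) (A : Set (List Bool)) : Prop :=
  ∃ Γ : RandomizedAlgorithm (List Bool) Bool,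
    0 < coinMeasure {X | ErrorFree (Γ.run X) A ∧
      ∃ᶠ n in atTop, r ≤ fraction (Γ.run X).Dom n}

/-! ### Enumerable predicates -/

section Enumerable

variable {α β γ : Type*} [Primcodable α] [Primcodable β] [Primcodable γ]

/-! Parts (a) and (c) rest on one measure game, `exists_diagonalization`. The player performs an
action once oracles of total measure at least `2 ^ (-k)` support it, counting only oracles not used
before. The used sets are disjoint, so there are at most `2 ^ k` actions. In the final position the
unused oracles supporting any one action have measure at most `2 ^ (-k)`. If every action spoils the
oracles behind it, the good oracles are never used and inherit this bound.

For (a), an action names, for several `n`, sets `Z` of slightly more than `2 ^ (n + 1 - 2j)`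
strings. An oracle supports it if, for some such `n`, the algorithm answers on almost all strings of
length at most `n`, and every `true` answer concerns a program with value outside `Z`. If there are
no errors, the unanswered strings are too few to contain programs for all of `Z`, so some element of
`Z` has complexity above `n`. But few actions occur, so by enumeration all elements of `Z` have
complexity at most `n - j + k + O(1)` (`IsOptimal.complexity_le_of_enumerable`). For large `j` this
is a contradiction, so supporting oracles make errors. Conversely, error-free oracles with dense
answers support a common action with fresh `Z`, once the number of bits read is bounded. Hence their
measure is at most `2 ^ (-k)` for every `k`.

For (c), an action picks a prefix of length `r` and puts into `S` all its extensions in a fresh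
interval of lengths; supporting oracles enumerate one of them. For each `r` there are finitely many
intervals and one prefix per length, so the densities `2 ^ (-r)` add up to density zero.

In the positive case of (b), the leading digits of the number of domain elements of length at most
`n` suffice as advice. Left-totality turns an upper bound on this number into refutations, and when
the bound is nearly sharp few strings stay undecided. One value of the leading digits is correct
infinitely often and not exceeded later; this gives infinitely many good `n`.

In the negative cases the simple set `S` of (c) is reduced to the domain: negative answers enumerate
non-elements of `S`, so almost surely an error-free algorithm leaves unanswered all but finitely
many queries coming from outside `S`. For effectively optimal machines the recursion theorem makes
the reduction injective, so the unanswered queries have positive density. To defeat a fixed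
threshold, the universal machine is confined to a small cone and the domain agrees with `S`
elsewhere. -/

theorem Primrec₂.re_exists {q : α → ℕ → Bool} (hq : Primrec₂ q) :
    REPred fun a => ∃ t, q a t = true := by
  have h : Partrec fun a => (Nat.rfind fun t => Part.some (q a t)).map fun _ => () :=
    (Partrec.rfind (Computable.partrec hq.to_comp).to₂).map (Computable.const ()).to₂
  refine h.dom_re.of_eq fun a => ?_
  refine Nat.rfind_dom.trans ?_
  constructor
  · rintro ⟨n, hn, -⟩
    exact ⟨n, (Part.mem_some_iff.1 hn).symm⟩
  · rintro ⟨n, hn⟩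
    exact ⟨n, by simp [hn], fun _ => trivial⟩

theorem PrimrecRel.re_exists {q : α → ℕ → Prop} (hq : PrimrecRel q) :
    REPred fun a => ∃ t, q a t := by
  have : DecidableRel q := fun _ _ => Classical.dec _
  exact (Primrec₂.re_exists hq.decide).of_eq fun a => by simp

theorem PrimrecPred.to_re {p : α → Prop} (hp : PrimrecPred p) : REPred p :=
  (PrimrecRel.re_exists (q := fun a _ => p a) (hp.comp Primrec.fst)).of_eq fun a => by simp

theorem REPred.comp {p : β → Prop} (hp : REPred p) {f : α → β} (hf : Computable f) :
    REPred fun a => p (f a) :=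
  Partrec.comp hp hf

/-- Evaluation with a step bound is primitive recursive. Its monotonicity in the bound is recorded
because it lets finitely many witnesses be merged into one by taking the maximal stage. -/
theorem REPred.exists_primrec {p : α → Prop} (hp : REPred p) :
    ∃ q : α → ℕ → Bool, Primrec₂ q ∧ (∀ a, p a ↔ ∃ t, q a t = true) ∧
      ∀ a s t, s ≤ t → q a s = true → q a t = true := by
  obtain ⟨c, hc⟩ := Nat.Partrec.Code.exists_code.1 hp
  refine ⟨fun a t => (Nat.Partrec.Code.evaln t c (Encodable.encode a)).isSome, ?_, ?_, ?_⟩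
  · exact Primrec.option_isSome.comp <| Nat.Partrec.Code.primrec_evaln.comp
      ((Primrec.snd.pair (Primrec.const c)).pair (Primrec.encode.comp Primrec.fst))
  · intro a
    have h1 : p a ↔ (Nat.Partrec.Code.eval c (Encodable.encode a)).Dom := by
      rw [hc]
      simp [Part.assert]
    rw [h1, Part.dom_iff_mem]
    constructor
    · rintro ⟨y, hy⟩
      obtain ⟨k, hk⟩ := Nat.Partrec.Code.evaln_complete.1 hy
      exact ⟨k, Option.isSome_iff_exists.2 ⟨y, hk⟩⟩
    · rintro ⟨k, hk⟩
      obtain ⟨y, hy⟩ := Option.isSome_iff_exists.1 hk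
      exact ⟨y, Nat.Partrec.Code.evaln_sound hy⟩
  · intro a s t hst hs
    obtain ⟨y, hy⟩ := Option.isSome_iff_exists.1 hs
    exact Option.isSome_iff_exists.2 ⟨y, Nat.Partrec.Code.evaln_mono hst hy⟩

theorem Primrec₂.rel {q : α → ℕ → Bool} (hq : Primrec₂ q) :
    PrimrecRel fun a t => q a t = true :=
  Primrec.eq.comp hq (Primrec.const true)

theorem REPred.and {p q : α → Prop} (hp : REPred p) (hq : REPred q) :
    REPred fun a => p a ∧ q a := by
  obtain ⟨p', hp', hpp, hpm⟩ := hp.exists_primrec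
  obtain ⟨q', hq', hqq, hqm⟩ := hq.exists_primrec
  refine (PrimrecRel.re_exists (q := fun a t => p' a t = true ∧ q' a t = true)
    (PrimrecPred.and hp'.rel hq'.rel)).of_eq fun a => ?_
  rw [hpp, hqq]
  constructor
  · rintro ⟨t, h1, h2⟩
    exact ⟨⟨t, h1⟩, t, h2⟩
  · rintro ⟨⟨s, h1⟩, t, h2⟩
    exact ⟨max s t, hpm _ _ _ (le_max_left _ _) h1, hqm _ _ _ (le_max_right _ _) h2⟩

theorem REPred.or {p q : α → Prop} (hp : REPred p) (hq : REPred q) :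
    REPred fun a => p a ∨ q a := by
  obtain ⟨p', hp', hpp, -⟩ := hp.exists_primrec
  obtain ⟨q', hq', hqq, -⟩ := hq.exists_primrec
  refine (PrimrecRel.re_exists (q := fun a t => p' a t = true ∨ q' a t = true)
    (PrimrecPred.or hp'.rel hq'.rel)).of_eq fun a => ?_
  rw [hpp, hqq, exists_or]

/-- Dovetailing: a single search variable codes a candidate `b` together with a stage. -/
theorem REPred.exists {p : α → β → Prop} (hp : REPred fun x : α × β => p x.1 x.2) :
    REPred fun a => ∃ b, p a b := by
  obtain ⟨p', hp', hpp, -⟩ := hp.exists_primrec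
  have h : Primrec₂ fun (a : α) (t : ℕ) =>
      ((Encodable.decode (α := β) t.unpair.1).map fun b => p' (a, b) t.unpair.2).getD false := by
    refine Primrec.option_getD.comp (Primrec.option_map
      (Primrec.decode.comp (Primrec.fst.comp (Primrec.unpair.comp Primrec.snd))) ?_)
      (Primrec.const false)
    exact hp'.comp (Primrec.pair (Primrec.fst.comp Primrec.fst) Primrec.snd)
      (Primrec.snd.comp (Primrec.unpair.comp (Primrec.snd.comp Primrec.fst)))
  refine h.re_exists.of_eq fun a => ?_
  constructor
  · rintro ⟨t, h⟩
    cases e : (Encodable.decode (α := β) t.unpair.1) with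
    | none => simp [e] at h
    | some b => exact ⟨b, (hpp (a, b)).2 ⟨t.unpair.2, by simpa [e] using h⟩⟩
  · rintro ⟨b, h⟩
    obtain ⟨t, ht⟩ := (hpp (a, b)).1 h
    exact ⟨Nat.pair (Encodable.encode b) t, by simpa using ht⟩

theorem REPred.forall_mem_list {p : α → β → Prop} (hp : REPred fun x : α × β => p x.1 x.2)
    {f : α → List β} (hf : Computable f) :
    REPred fun a => ∀ b ∈ f a, p a b := by
  have key : REPred fun x : List β × α => ∀ b ∈ x.1, p x.2 b := by
    obtain ⟨p', hp', hpp, hpm⟩ := hp.exists_primrec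
    have h : PrimrecRel fun (b : β) (x : α × ℕ) => p' (x.1, b) x.2 = true :=
      hp'.rel.comp (f := fun y : β × (α × ℕ) => (y.2.1, y.1)) (g := fun y => y.2.2)
        (Primrec.pair (Primrec.fst.comp Primrec.snd) Primrec.fst) (Primrec.snd.comp Primrec.snd)
    have h2 := h.forall_mem_list
    have h3 : PrimrecRel fun (x : List β × α) (t : ℕ) => ∀ b ∈ x.1, p' (x.2, b) t = true :=
      h2.comp (f := fun y : (List β × α) × ℕ => y.1.1) (g := fun y => (y.1.2, y.2))
        (Primrec.fst.comp Primrec.fst) (Primrec.pair (Primrec.snd.comp Primrec.fst) Primrec.snd)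
    refine h3.re_exists.of_eq fun x => ?_
    constructor
    · rintro ⟨t, ht⟩ b hb
      exact (hpp _).2 ⟨t, ht b hb⟩
    · obtain ⟨l, a⟩ := x
      intro h
      induction l with
      | nil => exact ⟨0, by simp⟩
      | cons b l ih =>
        obtain ⟨t, ht⟩ := ih fun b hb => h b (List.mem_cons_of_mem _ hb)
        obtain ⟨s, hs⟩ := (hpp (a, b)).1 (h b List.mem_cons_self)
        refine ⟨max s t, fun c hc => ?_⟩
        rcases List.mem_cons.1 hc with rfl | hc
        · exact hpm _ _ _ (le_max_left _ _) hs
        · exact hpm _ _ _ (le_max_right _ _) (ht c hc)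
  exact key.comp (hf.pair Computable.id)

theorem Partrec.re_mem {f : α →. β} (hf : Partrec f) :
    REPred fun x : α × β => x.2 ∈ f x.1 := by
  classical
  have h : Partrec fun x : α × β => (f x.1).bind fun b =>
      bif decide (b = x.2) then Part.some () else Part.none := by
    refine Partrec.bind (hf.comp Computable.fst) ?_
    refine Partrec.cond ?_ (Computable.const ()).partrec Partrec.none
    exact (Primrec.eq.decide.to_comp).comp Computable.snd (Computable.snd.comp Computable.fst)
  refine h.dom_re.of_eq fun x => ?_
  rw [Part.dom_iff_mem]
  constructor
  · rintro ⟨u, hu⟩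
    obtain ⟨b, hb, hb'⟩ := Part.mem_bind_iff.1 hu
    by_cases e : b = x.2
    · exact e ▸ hb
    · simp [e] at hb'
  · intro h
    exact ⟨(), Part.mem_bind_iff.2 ⟨_, h, by simp⟩⟩

theorem Partrec.re_mem_comp {f : β →. γ} (hf : Partrec f) {g : α → β} {h : α → γ}
    (hg : Computable g) (hh : Computable h) : REPred fun a => h a ∈ f (g a) :=
  hf.re_mem.comp (hg.pair hh)

/-- An enumerable relation has a partial computable choice function. -/
theorem REPred.exists_selector {p : α → β → Prop} (hp : REPred fun x : α × β => p x.1 x.2) :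
    ∃ f : α →. β, Partrec f ∧ (∀ a b, b ∈ f a → p a b) ∧ ∀ a, (∃ b, p a b) → (f a).Dom := by
  obtain ⟨p', hp', hpp, -⟩ := hp.exists_primrec
  let g : α → ℕ → Option β := fun a t => (Encodable.decode (α := β) t.unpair.1).bind fun b =>
    bif p' (a, b) t.unpair.2 then some b else none
  have hg : Primrec₂ g := by
    refine Primrec.option_bind
      (Primrec.decode.comp (Primrec.fst.comp (Primrec.unpair.comp Primrec.snd))) ?_
    refine Primrec.cond ?_ (Primrec.option_some.comp Primrec.snd) (Primrec.const _)
    exact hp'.comp (Primrec.pair (Primrec.fst.comp Primrec.fst) Primrec.snd)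
      (Primrec.snd.comp (Primrec.unpair.comp (Primrec.snd.comp Primrec.fst)))
  refine ⟨fun a => Nat.rfindOpt (g a), Partrec.rfindOpt hg.to_comp, fun a b hb => ?_, ?_⟩
  · obtain ⟨n, hn⟩ := Nat.rfindOpt_spec hb
    simp only [g, Option.mem_def, Option.bind_eq_some_iff] at hn
    obtain ⟨b', -, hb'⟩ := hn
    by_cases e : p' (a, b') n.unpair.2 = true
    · simp only [e, cond_true, Option.some.injEq] at hb'
      exact hb' ▸ (hpp (a, b')).2 ⟨_, e⟩
    · simp [e] at hb'
  · rintro a ⟨b, hb⟩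
    obtain ⟨t, ht⟩ := (hpp (a, b)).1 hb
    exact Nat.rfindOpt_dom.2 ⟨Nat.pair (Encodable.encode b) t, b, by simp [g, ht]⟩

/-- Two disjoint enumerable predicates are the two answers of a partial computable function. -/
theorem REPred.exists_separator {p q : α → Prop} (hp : REPred p) (hq : REPred q)
    (hpq : ∀ a, p a → ¬ q a) :
    ∃ f : α →. Bool, Partrec f ∧ (∀ a, true ∈ f a ↔ p a) ∧ ∀ a, false ∈ f a ↔ q a := by
  have h : REPred fun x : α × Bool => (x.2 = true ∧ p x.1) ∨ (x.2 = false ∧ q x.1) := by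
    refine REPred.or (REPred.and ?_ (hp.comp Computable.fst))
      (REPred.and ?_ (hq.comp Computable.fst))
    · exact (Primrec.eq.comp Primrec.snd (Primrec.const true)).to_re
    · exact (Primrec.eq.comp Primrec.snd (Primrec.const false)).to_re
  obtain ⟨f, hf, hs, hdom⟩ := REPred.exists_selector
    (p := fun a b => (b = true ∧ p a) ∨ (b = false ∧ q a)) h
  refine ⟨f, hf, fun a => ⟨fun h => by simpa using hs _ _ h, fun h => ?_⟩,
    fun a => ⟨fun h => by simpa using hs _ _ h, fun h => ?_⟩⟩
  · have hd := hdom a ⟨true, by simp [h]⟩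
    have hm := Part.get_mem hd
    have := hs _ _ hm
    rcases this with h1 | h1
    · rwa [h1.1] at hm
    · exact absurd h1.2 (hpq a h)
  · have hd := hdom a ⟨false, by simp [h]⟩
    have hm := Part.get_mem hd
    have := hs _ _ hm
    rcases this with h1 | h1
    · exact absurd h (hpq a h1.2)
    · rwa [h1.1] at hm

end Enumerable

/-! ### Canonical chains of actions -/

/-- `H i t` is the history after `t` actions (the last action first) of a process that performs
some action permitted by `p i` as long as there is one. -/
structure IsHistory {ι A : Type} (p : ι → List A → A → Prop) (H : ι → ℕ →. List A) : Prop where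
  zero : ∀ i, H i 0 = Part.some []
  step : ∀ i t l, l ∈ H i (t + 1) → ∃ b l', l = b :: l' ∧ l' ∈ H i t ∧ p i l' b
  extend : ∀ i t l, l ∈ H i t → (∃ b, p i l b) → (H i (t + 1)).Dom

/-- The next action is the one found by a fixed search among the permitted ones. The process is thus
computable, has only one course for each `i`, and stops only when nothing is permitted. -/
theorem REPred.exists_history {ι A : Type} [Primcodable ι] [Primcodable A]
    {p : ι → List A → A → Prop}
    (hp : REPred fun x : (ι × List A) × A => p x.1.1 x.1.2 x.2) :
    ∃ H : ι → ℕ →. List A, Partrec₂ H ∧ IsHistory p H := by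
  obtain ⟨f, hf, hfs, hfd⟩ := REPred.exists_selector (p := fun (a : ι × List A) b => p a.1 a.2 b) hp
  let H : ι → ℕ →. List A := fun i t => t.rec (Part.some []) fun _ l =>
    l.bind fun l => (f (i, l)).map fun b => b :: l
  refine ⟨H, ?_, fun i => rfl, fun i t l hl => ?_, fun i t l hl hb => ?_⟩
  · refine Partrec.nat_rec (f := fun x : ι × ℕ => x.2) (g := fun _ => Part.some [])
      (h := fun x y => (f (x.1, y.2)).map fun b => b :: y.2)
      Computable.snd (Computable.const []).partrec ?_
    refine Partrec.map (hf.comp ((Computable.fst.comp Computable.fst).pair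
      (Computable.snd.comp Computable.snd))) ?_
    exact Computable.list_cons.comp Computable.snd
      (Computable.snd.comp (Computable.snd.comp Computable.fst))
  · obtain ⟨l', hl', h⟩ := Part.mem_bind_iff.1 (show l ∈ (H i t).bind _ from hl)
    obtain ⟨b, hb, rfl⟩ := (Part.mem_map_iff _).1 h
    exact ⟨b, l', rfl, hl', hfs _ _ hb⟩
  · obtain ⟨b, hb⟩ := Part.dom_iff_mem.1 (hfd (i, l) hb)
    exact Part.dom_iff_mem.2 ⟨b :: l, Part.mem_bind_iff.2
      ⟨l, hl, (Part.mem_map_iff _).2 ⟨b, hb, rfl⟩⟩⟩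

namespace IsHistory

variable {ι A : Type} {p : ι → List A → A → Prop} {H : ι → ℕ →. List A}

theorem length_eq (h : IsHistory p H) {i t l} (hl : l ∈ H i t) : l.length = t := by
  induction t generalizing l with
  | zero => rw [h.zero, Part.mem_some_iff] at hl; simp [hl]
  | succ t ih =>
    obtain ⟨b, l', rfl, hl', -⟩ := h.step i t l hl
    simp [ih hl']

theorem mem_of_suffix (h : IsHistory p H) {i t l l'} (hl : l ∈ H i t) (hs : l' <:+ l) :
    l' ∈ H i l'.length := by
  induction t generalizing l with
  | zero =>
    rw [h.zero, Part.mem_some_iff] at hl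
    subst hl
    rw [List.suffix_nil.1 hs]
    simp [h.zero]
  | succ t ih =>
    obtain ⟨b, l₁, rfl, hl₁, -⟩ := h.step i t l hl
    rcases List.suffix_cons_iff.1 hs with rfl | hs
    · rwa [h.length_eq hl]
    · exact ih hl₁ hs

theorem legal (h : IsHistory p H) {i t l b l'} (hl : l ∈ H i t) (hs : b :: l' <:+ l) :
    p i l' b := by
  obtain ⟨b₁, l₁, e, -, hp⟩ := h.step i l'.length _ (h.mem_of_suffix hl hs)
  obtain ⟨rfl, rfl⟩ := List.cons_eq_cons.1 e
  exact hp

theorem suffix_of_le (h : IsHistory p H) {i s t l l'} (hl : l ∈ H i t)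
    (hl' : l' ∈ H i s) (hst : s ≤ t) :
    l' <:+ l := by
  have hlen := h.length_eq hl
  have hd : l.drop (t - s) <:+ l := List.drop_suffix _ _
  have := h.mem_of_suffix hl hd
  rw [List.length_drop, hlen, Nat.sub_sub_self hst] at this
  rwa [Part.mem_unique hl' this]

/-- If histories have bounded length, there is a longest one, which permits no further action. -/
theorem exists_maximal (h : IsHistory p H) {i M} (hM : ∀ t l, l ∈ H i t → t ≤ M) :
    ∃ t l, l ∈ H i t ∧ (∀ b, ¬ p i l b) ∧ ∀ s l', l' ∈ H i s → l' <:+ l := by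
  classical
  have h0 : (H i 0).Dom := by simp [h.zero]
  set t := Nat.findGreatest (fun t => (H i t).Dom) M with ht
  have hdom : (H i t).Dom := Nat.findGreatest_spec (P := fun t => (H i t).Dom) (Nat.zero_le M) h0
  obtain ⟨l, hl⟩ := Part.dom_iff_mem.1 hdom
  have hle : ∀ s, (H i s).Dom → s ≤ t := fun s hs => by
    obtain ⟨l', hl'⟩ := Part.dom_iff_mem.1 hs
    exact Nat.le_findGreatest (hM s l' hl') hs
  refine ⟨t, l, hl, fun b hb => ?_, fun s l' hl' => ?_⟩
  · have := hle _ (h.extend i t l hl ⟨b, hb⟩)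
    omega
  · exact h.suffix_of_le hl hl' (hle s (Part.dom_iff_mem.2 ⟨l', hl'⟩))

end IsHistory

/-- Finite sets, enumerable uniformly in `i`, can be enumerated without repetitions and gaps. -/
theorem REPred.exists_enumeration {ι β : Type} [Primcodable ι] [Primcodable β] {E : ι → β → Prop}
    (hE : REPred fun x : ι × β => E x.1 x.2)
    (hfin : ∀ i, {z | E i z}.Finite) :
    ∃ e : ι → ℕ →. β, Partrec₂ e ∧
      (∀ i z, E i z → ∃ t < {z | E i z}.ncard, z ∈ e i t) ∧
      (∀ i t z, z ∈ e i t → E i z) ∧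
      ∀ i s t, s ≤ t → (e i t).Dom → (e i s).Dom := by
  classical
  -- An action lists an element not listed so far. Histories then have no repetitions, their length
  -- is bounded by the cardinality, and the longest one lists everything.
  have hp : REPred fun x : (ι × List β) × β => E x.1.1 x.2 ∧ x.2 ∉ x.1.2 := by
    refine REPred.and (hE.comp ((Computable.fst.comp Computable.fst).pair Computable.snd)) ?_
    have h1 : PrimrecRel fun (l : List β) (b : β) => ∀ c ∈ l, ¬ c = b :=
      (Primrec.eq (α := β)).not.forall_mem_list
    refine (h1.comp (f := fun x : (ι × List β) × β => x.1.2) (g := fun x => x.2)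
      (Primrec.snd.comp Primrec.fst) Primrec.snd).to_re.of_eq fun x => ?_
    exact ⟨fun h hx => h _ hx rfl, fun h c hc e => h (e ▸ hc)⟩
  obtain ⟨H, hH, h⟩ := REPred.exists_history (p := fun i l b => E i b ∧ b ∉ l) hp
  have hmem : ∀ i t l, l ∈ H i t → ∀ z ∈ l, E i z := fun i t l hl z hz => by
    obtain ⟨s, r, rfl⟩ := List.append_of_mem hz
    exact (h.legal hl (List.suffix_append _ _)).1
  have hnodup : ∀ i t l, l ∈ H i t → l.Nodup := fun i t => by
    induction t with
    | zero => intro l hl; rw [h.zero, Part.mem_some_iff] at hl; simp [hl]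
    | succ t ih =>
      intro l hl
      obtain ⟨b, l', rfl, hl', hb⟩ := h.step i t l hl
      exact List.nodup_cons.2 ⟨hb.2, ih l' hl'⟩
  have hbound : ∀ i t l, l ∈ H i t → t ≤ {z | E i z}.ncard := fun i t l hl => by
    rw [← h.length_eq hl, ← List.toFinset_card_of_nodup (hnodup i t l hl), ← Set.ncard_coe_finset]
    exact Set.ncard_le_ncard (fun z hz => hmem i t l hl z (by simpa using hz)) (hfin i)
  -- The newest element of the history of length `t + 1` gets number `t`. There are no gaps because
  -- tails of histories are histories.
  refine ⟨fun i t => (H i (t + 1)).bind fun l => (l.head? : Part β), ?_, ?_, ?_, ?_⟩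
  · refine Partrec.bind (hH.comp Computable.fst (Computable.succ.comp Computable.snd)) ?_
    exact Computable.ofOption (Primrec.list_head?.to_comp.comp Computable.snd)
  · intro i z hz
    obtain ⟨t, l, hl, hmax, -⟩ := h.exists_maximal (hbound i)
    have hzl : z ∈ l := by
      by_contra hzl
      exact hmax z ⟨hz, hzl⟩
    obtain ⟨s, r, rfl⟩ := List.append_of_mem hzl
    have h1 := h.mem_of_suffix hl (List.suffix_append s (z :: r))
    have h2 := hbound i _ _ h1
    exact ⟨r.length, h2, Part.mem_bind_iff.2 ⟨_, h1, by simp⟩⟩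
  · intro i t z hz
    obtain ⟨l, hl, hz⟩ := Part.mem_bind_iff.1 hz
    exact hmem i _ l hl z (List.mem_of_head? (by simpa using hz))
  · intro i s t hst hd
    obtain ⟨z, hz⟩ := Part.dom_iff_mem.1 hd
    obtain ⟨l, hl, -⟩ := Part.mem_bind_iff.1 hz
    have h1 := h.mem_of_suffix hl (List.drop_suffix (t - s) l)
    rw [List.length_drop, h.length_eq hl, show t + 1 - (t - s) = s + 1 by omega] at h1
    obtain ⟨b, l', e, -⟩ := h.step i s _ h1
    exact Part.dom_iff_mem.2 ⟨b, Part.mem_bind_iff.2 ⟨_, h1, by simp [e]⟩⟩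

/-! ### Binary strings -/

theorem Primrec.nat_pow : Primrec₂ ((· ^ ·) : ℕ → ℕ → ℕ) :=
  Primrec₂.unpaired'.1 Nat.Primrec.pow

/-- The number with binary notation `w`. -/
def bitValue : List Bool → ℕ
  | [] => 0
  | b :: l => b.toNat * 2 ^ l.length + bitValue l

theorem bitValue_lt (w : List Bool) : bitValue w < 2 ^ w.length := by
  induction w with
  | nil => simp [bitValue]
  | cons b l ih => cases b <;> simp [bitValue, pow_succ] <;> omega

theorem exists_bitValue_eq (n t : ℕ) (ht : t < 2 ^ n) :
    ∃ w : List Bool, w.length = n ∧ bitValue w = t := by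
  induction n generalizing t with
  | zero => exact ⟨[], rfl, by simp at ht; simp [bitValue, ht]⟩
  | succ n ih =>
    by_cases h : t < 2 ^ n
    · obtain ⟨w, hw, rfl⟩ := ih t h
      exact ⟨false :: w, by simp [hw], by simp [bitValue]⟩
    · obtain ⟨w, hw, hv⟩ := ih (t - 2 ^ n) (by rw [pow_succ] at ht; omega)
      exact ⟨true :: w, by simp [hw], by simp [bitValue, hw, hv]; omega⟩

theorem lt_iff_bitValue_lt {p q : List Bool} (h : p.length = q.length) :
    p < q ↔ bitValue p < bitValue q := by
  induction p generalizing q with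
  | nil => cases q with
    | nil => simp
    | cons b q => simp at h
  | cons a p ih => cases q with
    | nil => simp at h
    | cons b q =>
      have h' : p.length = q.length := by simpa using h
      have h1 := bitValue_lt p
      have h2 := bitValue_lt q
      rw [h'] at h1
      rw [List.cons_lt_cons_iff, ih h']
      cases a <;> cases b <;> simp [bitValue, h']
      · omega
      · exact iff_of_false (by decide) (by omega)

theorem bitValue_injective {p q : List Bool} (h : p.length = q.length)
    (hv : bitValue p = bitValue q) : p = q := by
  rcases lt_trichotomy p q with h1 | h1 | h1
  · exact absurd ((lt_iff_bitValue_lt h).1 h1) (by omega)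
  · exact h1
  · exact absurd ((lt_iff_bitValue_lt h.symm).1 h1) (by omega)

theorem primrec_bitValue : Primrec bitValue := by
  have h : Primrec fun w : List Bool => List.rec (motive := fun _ => ℕ) 0
      (fun b l ih => b.toNat * 2 ^ l.length + ih) w := by
    refine Primrec.list_rec
      (h := fun _ (x : Bool × List Bool × ℕ) => x.1.toNat * 2 ^ x.2.1.length + x.2.2)
      Primrec.id (Primrec.const 0) ?_
    refine Primrec.nat_add.comp (Primrec.nat_mul.comp ?_ ?_) ?_
    · exact (Primrec.dom_bool Bool.toNat).comp (Primrec.fst.comp Primrec.snd)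
    · exact Primrec.nat_pow.comp (Primrec.const 2)
        (Primrec.list_length.comp (Primrec.fst.comp (Primrec.snd.comp Primrec.snd)))
    · exact Primrec.snd.comp (Primrec.snd.comp Primrec.snd)
  refine h.of_eq fun w => ?_
  induction w with
  | nil => rfl
  | cons b l ih => simp [bitValue, ih]

/-- Prefixes `w` with a self-delimiting description of `j`. -/
def withHeader (j : ℕ) (w : List Bool) : List Bool :=
  List.replicate j true ++ false :: w

theorem length_withHeader (j : ℕ) (w : List Bool) :
    (withHeader j w).length = w.length + (j + 1) := by
  simp [withHeader]; omega

/-- Splits `withHeader j w` into `j` and `w`. -/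
def splitHeader (p : List Bool) : ℕ × List Bool :=
  ((p.takeWhile id).length, (p.dropWhile id).drop 1)

theorem splitHeader_withHeader (j : ℕ) (w : List Bool) :
    splitHeader (withHeader j w) = (j, w) := by
  induction j with
  | zero => simp [splitHeader, withHeader]
  | succ j ih =>
    simp only [splitHeader, withHeader, Prod.mk.injEq] at ih ⊢
    simp [List.replicate_succ]

theorem primrec_splitHeader : Primrec splitHeader :=
  Primrec.pair (Primrec.list_length.comp (Primrec.list_takeWhile Primrec.id))
    (Primrec.list_drop.comp (Primrec.const 1) (Primrec.list_dropWhile Primrec.id))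

theorem primrec_withHeader : Primrec₂ withHeader := by
  have h : Primrec fun j : ℕ => List.replicate j true :=
    (Primrec.list_map Primrec.list_range (Primrec.const true).to₂).of_eq fun j => by
      simp [List.map_const']
  exact Primrec.list_append.comp (h.comp Primrec.fst)
    (Primrec.list_cons.comp (Primrec.const false) Primrec.snd)

/-! ### Machines from enumerations -/

theorem complexity_le {U : List Bool →. List Bool} {p x : List Bool} (h : x ∈ U p) :
    complexity U x ≤ p.length :=
  iInf₂_le p h

theorem exists_program {U : List Bool →. List Bool} {x : List Bool} {n : ℕ}
    (h : complexity U x ≤ n) : ∃ p, x ∈ U p ∧ p.length ≤ n := by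
  have h1 : complexity U x < (n : ℕ∞) + 1 :=
    lt_of_le_of_lt h (by exact_mod_cast Nat.lt_succ_self n)
  obtain ⟨p, hp⟩ := iInf_lt_iff.1 h1
  obtain ⟨hx, hp⟩ := iInf_lt_iff.1 hp
  have : p.length < n + 1 := by exact_mod_cast hp
  exact ⟨p, hx, by omega⟩

/-- If sets `E j m` with at most `2 ^ m` elements are enumerable uniformly in `j` and `m`, then
their elements have complexity at most `m + j + O(1)`. -/
theorem IsOptimal.complexity_le_of_enumerable {U : List Bool →. List Bool} (hU : IsOptimal U)
    {E : ℕ × ℕ → List Bool → Prop} (hE : REPred fun x : (ℕ × ℕ) × List Bool => E x.1 x.2)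
    (hfin : ∀ i, {z | E i z}.Finite) (hcard : ∀ i, {z | E i z}.ncard ≤ 2 ^ i.2) :
    ∃ c : ℕ, ∀ j m z, E (j, m) z → complexity U z ≤ (m + j + c : ℕ) := by
  obtain ⟨e, he, hsurj, -, -⟩ := hE.exists_enumeration hfin
  -- The header costs `j + 1` bits. The other `m` bits are the number of the element in the
  -- enumeration of `E (j, m)`; their count conveys `m` at no extra cost.
  let V : List Bool →. List Bool := fun p =>
    e ((splitHeader p).1, (splitHeader p).2.length) (bitValue (splitHeader p).2)
  have hV : Partrec V := by
    have h1 := primrec_splitHeader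
    refine Partrec₂.comp he (Primrec.to_comp ?_) (Primrec.to_comp ?_)
    · exact (Primrec.fst.comp h1).pair (Primrec.list_length.comp (Primrec.snd.comp h1))
    · exact primrec_bitValue.comp (Primrec.snd.comp h1)
  obtain ⟨c, hc⟩ := hU.2 V hV
  refine ⟨1 + c, fun j m z hz => ?_⟩
  obtain ⟨t, ht, hzt⟩ := hsurj (j, m) z hz
  obtain ⟨w, hw, rfl⟩ := exists_bitValue_eq m t (ht.trans_le (hcard (j, m)))
  have h1 : z ∈ V (withHeader j w) := by
    simp only [V, splitHeader_withHeader, hw]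
    exact hzt
  refine (hc z).trans ((add_le_add_left (complexity_le h1) _).trans (le_of_eq ?_))
  rw [length_withHeader, hw]
  push_cast
  ring

/-! ### The coin measure of cylinders -/

instance : IsProbabilityMeasure coinMeasure := by
  unfold coinMeasure; infer_instance

theorem length_bitPrefix (X : ℕ → Bool) (k : ℕ) : (bitPrefix X k).length = k := by
  simp [bitPrefix]

theorem take_bitPrefix (X : ℕ → Bool) {k n : ℕ} (h : k ≤ n) :
    (bitPrefix X n).take k = bitPrefix X k := by
  simp [bitPrefix, ← List.map_take, List.take_range, h]

theorem bitPrefix_eq_iff {X : ℕ → Bool} {σ : List Bool} :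
    bitPrefix X σ.length = σ ↔ ∀ i ∈ Finset.range σ.length, X i = σ.getD i false := by
  constructor
  · intro h i hi
    have hi' : i < σ.length := by simpa using hi
    rw [List.getD_eq_getElem _ _ hi', ← List.getElem_of_eq h (by simpa [bitPrefix] using hi')]
    simp [bitPrefix]
  · intro h
    refine List.ext_getElem (length_bitPrefix _ _) fun i h1 h2 => ?_
    simp [bitPrefix, h i (by simpa using h2), h2]

theorem measurableSet_cylinder_bitPrefix (σ : List Bool) :
    MeasurableSet {X : ℕ → Bool | bitPrefix X σ.length = σ} := by
  simp only [bitPrefix_eq_iff, Set.ofPred_forall]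
  refine MeasurableSet.iInter fun i => MeasurableSet.iInter fun _ => ?_
  exact measurable_pi_apply i (measurableSet_singleton _)

theorem coinMeasure_cylinder (σ : List Bool) :
    coinMeasure {X | bitPrefix X σ.length = σ} = (2 ^ σ.length)⁻¹ := by
  have h : {X : ℕ → Bool | bitPrefix X σ.length = σ} =
      Set.pi (Finset.range σ.length) fun i => {σ.getD i false} := by
    ext X
    simp only [Set.mem_ofPred_eq, bitPrefix_eq_iff]
    simp [Set.mem_pi]
  rw [h, coinMeasure, Measure.infinitePi_pi _ (fun _ _ => measurableSet_singleton _)]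
  simp [ENNReal.inv_pow]

theorem coinMeasure_prefix_mem (N : ℕ) (F : Finset (List Bool)) (hF : ∀ σ ∈ F, σ.length = N) :
    MeasurableSet {X | bitPrefix X N ∈ F} ∧
      coinMeasure {X | bitPrefix X N ∈ F} = F.card * (2 ^ N)⁻¹ := by
  have h : {X | bitPrefix X N ∈ F} = ⋃ σ ∈ F, {X | bitPrefix X σ.length = σ} := by
    ext X
    simp only [Set.mem_ofPred_eq, Set.mem_iUnion, exists_prop]
    exact ⟨fun h => ⟨_, h, by rw [length_bitPrefix]⟩, fun ⟨σ, hσ, e⟩ => by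
      rw [← hF σ hσ, e]; exact hσ⟩
  rw [h]
  refine ⟨F.measurableSet_biUnion fun σ _ => measurableSet_cylinder_bitPrefix σ, ?_⟩
  rw [measure_biUnion_finset _ fun σ _ => measurableSet_cylinder_bitPrefix σ]
  · rw [Finset.sum_congr rfl fun σ hσ => by rw [coinMeasure_cylinder, hF σ hσ]]
    simp
  · intro σ hσ τ hτ hne
    refine Set.disjoint_left.2 fun X h1 h2 => hne ?_
    have h1 : bitPrefix X σ.length = σ := h1
    have h2 : bitPrefix X τ.length = τ := h2
    rw [hF _ hσ] at h1
    rw [hF _ hτ] at h2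
    exact h1.symm.trans h2

/-! ### Diagonalization against randomized algorithms -/

section Game

variable {ι B : Type}

/-- An action `b` together with the oracle prefixes, all of length `N`, that justify it. -/
abbrev Attack (B : Type) : Type := B × ℕ × List (List Bool)

/-- The oracles touched by an attack. -/
def Attack.target (a : Attack B) : Set (ℕ → Bool) := {X | bitPrefix X a.2.1 ∈ a.2.2}

/-- Attack `a` is permitted after the attacks `H`: its prefixes extend no earlier ones, support
the action, and have total measure at least `2 ^ (-k i)`. -/
def Attack.Legal (R : ι → List B → B → List Bool → Prop) (k : ι → ℕ) (i : ι)
    (H : List (Attack B)) (a : Attack B) : Prop :=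
  a.2.2.Nodup ∧ 2 ^ a.2.1 ≤ a.2.2.length * 2 ^ k i ∧ (∀ σ ∈ a.2.2, σ.length = a.2.1 ∧
    (∀ a' ∈ H, a'.2.1 ≤ σ.length ∧ σ.take a'.2.1 ∉ a'.2.2) ∧
    ∃ m, R i (H.map Prod.fst) a.1 (σ.take m))

theorem PrimrecPred.list_nodup {α : Type*} [Primcodable α] :
    PrimrecPred fun l : List α => l.Nodup := by
  classical
  have hmem : PrimrecRel fun (l : List α) (b : α) => ∀ c ∈ l, ¬ c = b :=
    (Primrec.eq (α := α)).not.forall_mem_list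
  have h : Primrec fun w : List α => List.rec (motive := fun _ => Bool) true
      (fun b l ih => ih && decide (∀ c ∈ l, ¬ c = b)) w := by
    refine Primrec.list_rec
      (h := fun _ (x : α × List α × Bool) => x.2.2 && decide (∀ c ∈ x.2.1, ¬ c = x.1))
      Primrec.id (Primrec.const true) ?_
    refine Primrec.and.comp (Primrec.snd.comp (Primrec.snd.comp Primrec.snd)) ?_
    exact hmem.decide.comp (Primrec.fst.comp (Primrec.snd.comp Primrec.snd))
      (Primrec.fst.comp Primrec.snd)
  refine (Primrec.eq.comp h (Primrec.const true)).of_eq fun w => ?_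
  induction w with
  | nil => simp
  | cons b l ih =>
    rw [List.nodup_cons, ← ih]
    simp only [Bool.and_eq_true, decide_eq_true_eq]
    exact ⟨fun h => ⟨fun hb => h.2 b hb rfl, h.1⟩, fun h => ⟨h.2, fun c hc e => h.1 (e ▸ hc)⟩⟩

theorem PrimrecRel.list_mem {α : Type*} [Primcodable α] :
    PrimrecRel fun (a : α) (l : List α) => a ∈ l :=
  ((Primrec.eq (α := α)).exists_mem_list.comp (f := fun x : α × List α => x.2)
    (g := fun x => x.1) Primrec.snd Primrec.fst).of_eq fun x => by simp

theorem Attack.re_legal [Primcodable ι] [Primcodable B] {R : ι → List B → B → List Bool → Prop}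
    (hR : REPred fun x : ((ι × List B) × B) × List Bool => R x.1.1.1 x.1.1.2 x.1.2 x.2)
    {k : ι → ℕ} (hk : Primrec k) :
    REPred fun x : (ι × List (Attack B)) × Attack B => Attack.Legal R k x.1.1 x.1.2 x.2 := by
  have hF : Primrec fun x : (ι × List (Attack B)) × Attack B => x.2.2.2 :=
    Primrec.snd.comp (Primrec.snd.comp Primrec.snd)
  have hN : Primrec fun x : (ι × List (Attack B)) × Attack B => x.2.2.1 :=
    Primrec.fst.comp (Primrec.snd.comp Primrec.snd)
  refine REPred.and (PrimrecPred.list_nodup.comp hF).to_re (REPred.and ?_ ?_)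
  · refine (Primrec.nat_le.comp (Primrec.nat_pow.comp (Primrec.const 2) hN)
      (Primrec.nat_mul.comp (Primrec.list_length.comp hF)
        (Primrec.nat_pow.comp (Primrec.const 2)
          (hk.comp (Primrec.fst.comp Primrec.fst))))).to_re
  · refine REPred.forall_mem_list (p := fun (x : (ι × List (Attack B)) × Attack B) σ =>
      σ.length = x.2.2.1 ∧ (∀ a' ∈ x.1.2, a'.2.1 ≤ σ.length ∧ σ.take a'.2.1 ∉ a'.2.2) ∧
        ∃ m, R x.1.1 (x.1.2.map Prod.fst) x.2.1 (σ.take m)) ?_ hF.to_comp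
    refine REPred.and ?_ (REPred.and ?_ ?_)
    · exact (Primrec.eq.comp (Primrec.list_length.comp Primrec.snd)
        (hN.comp Primrec.fst)).to_re
    · refine REPred.forall_mem_list
        (p := fun (x : ((ι × List (Attack B)) × Attack B) × List Bool) a' =>
          a'.2.1 ≤ x.2.length ∧ x.2.take a'.2.1 ∉ a'.2.2) ?_
        (Computable.snd.comp (Computable.fst.comp Computable.fst))
      have h1 : Primrec fun x : (((ι × List (Attack B)) × Attack B) × List Bool) × Attack B =>
          x.2.2.1 := Primrec.fst.comp (Primrec.snd.comp Primrec.snd)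
      have h2 : Primrec fun x : (((ι × List (Attack B)) × Attack B) × List Bool) × Attack B =>
          x.1.2 := Primrec.snd.comp Primrec.fst
      refine PrimrecPred.to_re (PrimrecPred.and ?_ (PrimrecPred.not ?_))
      · exact Primrec.nat_le.comp h1 (Primrec.list_length.comp h2)
      · exact PrimrecRel.list_mem.comp (Primrec.list_take.comp h1 h2)
          (Primrec.snd.comp (Primrec.snd.comp Primrec.snd))
    · refine REPred.exists
        (p := fun (x : ((ι × List (Attack B)) × Attack B) × List Bool) m =>
          R x.1.1.1 (x.1.1.2.map Prod.fst) x.1.2.1 (x.2.take m)) ?_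
      let f : (((ι × List (Attack B)) × Attack B) × List Bool) × ℕ →
          ((ι × List B) × B) × List Bool := fun x =>
        (((x.1.1.1.1, x.1.1.1.2.map Prod.fst), x.1.1.2.1), x.1.2.take x.2)
      have h1 : Primrec f := by
        refine Primrec.pair (Primrec.pair (Primrec.pair ?_ ?_) ?_) ?_
        · exact Primrec.fst.comp (Primrec.fst.comp (Primrec.fst.comp Primrec.fst))
        · have h3 : Primrec fun l : List (Attack B) => l.map Prod.fst :=
            Primrec.list_map Primrec.id (Primrec.fst.comp Primrec.snd).to₂
          exact h3.comp (Primrec.snd.comp (Primrec.fst.comp (Primrec.fst.comp Primrec.fst)))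
        · exact Primrec.fst.comp (Primrec.snd.comp (Primrec.fst.comp Primrec.fst))
        · exact Primrec.list_take.comp Primrec.snd (Primrec.snd.comp Primrec.fst)
      exact REPred.comp hR (f := f) h1.to_comp

/-- The target consists of distinct cylinders of measure `2 ^ (-N)` each, so the counting clause is
a measure bound; prefixes that extend no earlier ones make the targets disjoint. -/
theorem Attack.Legal.measure {R : ι → List B → B → List Bool → Prop} {k : ι → ℕ} {i : ι}
    {H : List (Attack B)} {a : Attack B} (h : Attack.Legal R k i H a) :
    MeasurableSet a.target ∧ (2 ^ k i)⁻¹ ≤ coinMeasure a.target ∧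
      ∀ a' ∈ H, Disjoint a.target (Attack.target a') := by
  classical
  obtain ⟨hnd, hlen, hσ⟩ := h
  have h1 := coinMeasure_prefix_mem a.2.1 a.2.2.toFinset fun σ h => (hσ σ (by simpa using h)).1
  simp only [List.mem_toFinset, List.toFinset_card_of_nodup hnd] at h1
  refine ⟨h1.1, ?_, fun a' ha' => Set.disjoint_left.2 fun X hX hX' => ?_⟩
  · refine le_of_le_of_eq ?_ h1.2.symm
    rw [← div_eq_mul_inv, ENNReal.le_div_iff_mul_le (by simp) (by simp), mul_comm,
      ← div_eq_mul_inv]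
    refine ENNReal.div_le_of_le_mul ?_
    exact_mod_cast hlen
  · obtain ⟨h2, h3, -⟩ := hσ _ hX
    obtain ⟨h4, h5⟩ := h3 a' ha'
    rw [length_bitPrefix] at h4
    rw [take_bitPrefix X h4] at h5
    exact h5 hX'

/-- Disjoint targets of measure at least `2 ^ (-k i)` each fit into total measure one at most `2 ^ k
i` times. -/
theorem IsHistory.attack_bound {R : ι → List B → B → List Bool → Prop} {k : ι → ℕ}
    {H : ι → ℕ →. List (Attack B)} (h : IsHistory (Attack.Legal R k) H) {i t l}
    (hl : l ∈ H i t) : t ≤ 2 ^ k i := by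
  have key : ∀ t l, l ∈ H i t → MeasurableSet (⋃ a ∈ l, Attack.target a) ∧
      t * (2 ^ k i : ENNReal)⁻¹ ≤ coinMeasure (⋃ a ∈ l, Attack.target a) := by
    intro t
    induction t with
    | zero => intro l hl; rw [h.zero, Part.mem_some_iff] at hl; simp [hl]
    | succ t ih =>
      intro l hl
      obtain ⟨a, l', rfl, hl', ha⟩ := h.step i t l hl
      obtain ⟨h1, h2⟩ := ih l' hl'
      obtain ⟨h3, h4, h5⟩ := ha.measure
      have e : (⋃ a' ∈ a :: l', Attack.target a') =
          a.target ∪ ⋃ a' ∈ l', Attack.target a' := by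
        ext X; simp
      rw [e]
      refine ⟨h3.union h1, ?_⟩
      rw [measure_union _ h1]
      · push_cast
        rw [add_mul, one_mul, add_comm]
        exact add_le_add h4 h2
      · simp only [Set.disjoint_iUnion_right]
        exact h5
  have h1 := ((key t l hl).2.trans prob_le_one)
  rw [← div_eq_mul_inv, ENNReal.div_le_iff (by simp) (by simp), one_mul] at h1
  exact_mod_cast h1

/-- Uniformly in `i`, actions can be performed one after another as long as the oracles that
support the next action and do not support the earlier ones have measure more than `2 ^ (-k i)`.
The set of histories is enumerable, `Hmax` is the final history, and `K` consists of the oracles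
that were used in support of some action. -/
theorem exists_diagonalization [Primcodable ι] [Primcodable B]
    {R : ι → List B → B → List Bool → Prop}
    (hR : REPred fun x : ((ι × List B) × B) × List Bool => R x.1.1.1 x.1.1.2 x.1.2 x.2)
    {k : ι → ℕ} (hk : Primrec k) :
    ∃ Hist : ι → List B → Prop, REPred (fun x : ι × List B => Hist x.1 x.2) ∧
      ∀ i, ∃ (Hmax : List B) (K : Set (ℕ → Bool)),
        Hist i Hmax ∧ Hmax.length ≤ 2 ^ k i ∧ (∀ l, Hist i l → l <:+ Hmax) ∧
        (∀ l b, b :: l <:+ Hmax → Hist i (b :: l) ∧ ∃ σ, R i l b σ) ∧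
        (∀ X ∈ K, ∃ l b n, b :: l <:+ Hmax ∧ R i l b (bitPrefix X n)) ∧
        ∀ (b : B) (G : Set (ℕ → Bool)), Disjoint G K →
          (∀ X ∈ G, ∃ n, R i Hmax b (bitPrefix X n)) → coinMeasure G ≤ (2 ^ k i)⁻¹ := by
  classical
  obtain ⟨H, hH, h⟩ := (Attack.re_legal hR hk).exists_history
  refine ⟨fun i l => ∃ x : ℕ × List (Attack B), x.2 ∈ H i x.1 ∧ x.2.map Prod.fst = l, ?_,
    fun i => ?_⟩
  · refine REPred.exists (p := fun (y : ι × List B) (x : ℕ × List (Attack B)) =>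
      x.2 ∈ H y.1 x.1 ∧ x.2.map Prod.fst = y.2) (REPred.and ?_ ?_)
    · exact Partrec.re_mem_comp (f := fun y : ι × ℕ => H y.1 y.2) hH
        ((Computable.fst.comp Computable.fst).pair (Computable.fst.comp Computable.snd))
        (Computable.snd.comp Computable.snd)
    · refine (Primrec.eq.comp (Primrec.list_map (Primrec.snd.comp Primrec.snd)
        (Primrec.fst.comp Primrec.snd).to₂) (Primrec.snd.comp Primrec.fst)).to_re
  · obtain ⟨t, l, hl, hmax, hsuf⟩ := h.exists_maximal (i := i) fun t l hl => h.attack_bound hl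
    have hle := h.attack_bound hl
    have hlen := h.length_eq hl
    refine ⟨l.map Prod.fst, ⋃ a ∈ l, Attack.target a, ⟨(t, l), hl, rfl⟩, by simpa [hlen] using hle,
      ?_, ?_, ?_, ?_⟩
    · rintro _ ⟨⟨s, l'⟩, hl', rfl⟩
      exact (hsuf s l' hl').map _
    · intro l₁ b hb
      obtain ⟨r, hr⟩ := hb
      obtain ⟨r', l', rfl, -, hl'⟩ := List.map_eq_append_iff.1 hr.symm
      obtain ⟨a, l'', rfl, rfl, rfl⟩ := List.map_eq_cons_iff.1 hl'
      have h1 := h.mem_of_suffix hl (List.suffix_append r' (a :: l''))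
      refine ⟨⟨(_, _), h1, rfl⟩, ?_⟩
      have h2 := h.legal hl (List.suffix_append r' (a :: l''))
      -- The measure requirement excludes an empty list of prefixes, so at least one prefix
      -- witnesses the support.
      have h3 : a.2.2 ≠ [] := by
        intro e
        have := h2.2.1
        simp [e] at this
      obtain ⟨σ, hσ⟩ := List.exists_mem_of_ne_nil _ h3
      obtain ⟨-, -, m, hm⟩ := h2.2.2 σ hσ
      exact ⟨_, hm⟩
    · intro X hX
      simp only [Set.mem_iUnion] at hX
      obtain ⟨a, ha, hX⟩ := hX
      obtain ⟨r, l', rfl⟩ := List.append_of_mem ha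
      obtain ⟨-, -, hσ⟩ := h.legal hl (List.suffix_append r (a :: l'))
      obtain ⟨-, -, m, hm⟩ := hσ _ hX
      -- The number `m` of bits taken may exceed the length of the prefix, hence the minimum.
      refine ⟨l'.map Prod.fst, a.1, min m a.2.1, ⟨r.map Prod.fst, by simp⟩, ?_⟩
      rw [← take_bitPrefix X (min_le_right m a.2.1)]
      rcases le_total m a.2.1 with hma | hma
      · rwa [min_eq_left hma]
      · rw [List.take_of_length_le (by rw [length_bitPrefix]; exact hma)] at hm
        rwa [min_eq_right hma, List.take_of_length_le (by rw [length_bitPrefix])]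
    · intro b G hG hGR
      by_contra hlt
      rw [not_le] at hlt
      -- Prefixes at least this long already determine whether the oracle was touched by an earlier
      -- attack.
      obtain ⟨N₀, hN₀⟩ : ∃ N₀, ∀ a ∈ l, a.2.1 ≤ N₀ :=
        ⟨(l.map fun a => a.2.1).sum, fun a ha =>
          List.single_le_sum (by simp) _ (List.mem_map_of_mem ha)⟩
      let GN : ℕ → Set (ℕ → Bool) := fun N =>
        {X ∈ G | ∃ n ≤ N, R i (l.map Prod.fst) b (bitPrefix X n)}
      have hmono : Monotone GN := fun M N hMN X hX =>
        ⟨hX.1, hX.2.imp fun n hn => ⟨hn.1.trans hMN, hn.2⟩⟩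
      have hU : G = ⋃ N, GN N := by
        ext X
        simp only [Set.mem_iUnion]
        exact ⟨fun hX => (hGR X hX).imp fun n hn => ⟨hX, n, le_rfl, hn⟩, fun ⟨N, hN⟩ => hN.1⟩
      -- By continuity from below, the oracles whose support is visible within some finite number of
      -- bits already have too large a measure. Their prefixes form a legal attack, contradicting
      -- the maximality of the history.
      rw [hU, hmono.measure_iUnion, lt_iSup_iff] at hlt
      obtain ⟨N₁, hlt⟩ := hlt
      set N := max N₀ N₁
      replace hlt := hlt.trans_le (measure_mono (hmono (le_max_right N₀ N₁)))
      let F : Finset (List Bool) := (List.finite_length_eq Bool N).toFinset.filter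
        fun σ => ∃ X ∈ GN N, bitPrefix X N = σ
      have hF : ∀ σ ∈ F, σ.length = N := fun σ hσ => by
        simpa using (Finset.mem_filter.1 hσ).1
      have hF' : GN N ⊆ {X | bitPrefix X N ∈ F} := fun X hX =>
        Finset.mem_filter.2 ⟨by simp [length_bitPrefix], X, hX, rfl⟩
      have h1 := hlt.trans_le (measure_mono hF')
      rw [(coinMeasure_prefix_mem N F hF).2] at h1
      refine hmax (b, N, F.toList) ⟨F.nodup_toList, ?_, fun σ hσ => ?_⟩
      · have h2 := h1.le
        rw [← div_eq_mul_inv, ENNReal.le_div_iff_mul_le (by simp) (by simp), mul_comm,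
          ← div_eq_mul_inv, ENNReal.div_le_iff (by simp) (by simp)] at h2
        simp only [Finset.length_toList]
        exact_mod_cast h2
      · obtain ⟨-, X, hX, rfl⟩ := Finset.mem_filter.1 (Finset.mem_toList.1 hσ)
        refine ⟨length_bitPrefix _ _, fun a ha => ?_, ?_⟩
        · have hN : a.2.1 ≤ N := (hN₀ a ha).trans (le_max_left _ _)
          refine ⟨by rwa [length_bitPrefix], ?_⟩
          rw [take_bitPrefix X hN]
          exact fun hXa => Set.disjoint_left.1 hG hX.1 (Set.mem_biUnion ha hXa)
        · obtain ⟨n, hn, hr⟩ := hX.2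
          exact ⟨n, by rwa [take_bitPrefix X hn]⟩

end Game

/-! ### Counting strings -/

theorem finite_length_le (n : ℕ) : {x : List Bool | x.length ≤ n}.Finite :=
  List.finite_length_le Bool n

theorem finite_length_le_and (A : Set (List Bool)) (n : ℕ) :
    {x : List Bool | x.length ≤ n ∧ x ∈ A}.Finite :=
  (finite_length_le n).subset fun _ h => h.1

theorem ncard_length_eq (n : ℕ) : {x : List Bool | x.length = n}.ncard = 2 ^ n := by
  have h := Set.ncard_congr (s := {x : List Bool | x.length = n}) (t := Set.Iio (2 ^ n))
    (fun x _ => bitValue x) (fun x hx => hx ▸ bitValue_lt x)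
    (fun x y hx hy h => bitValue_injective (hx.trans hy.symm) h)
    (fun t ht => (exists_bitValue_eq n t ht).imp fun w hw => ⟨hw.1, hw.2⟩)
  rw [h, ← Finset.coe_Iio, Set.ncard_coe_finset, Nat.card_Iio]

theorem ncard_length_le_and_eq_sum (A : Set (List Bool)) (n : ℕ) :
    {x : List Bool | x.length ≤ n ∧ x ∈ A}.ncard =
      ∑ m ∈ Finset.range (n + 1), {x : List Bool | x.length = m ∧ x ∈ A}.ncard := by
  induction n with
  | zero => simp
  | succ n ih =>
    rw [Finset.sum_range_succ, ← ih, ← Set.ncard_union_eq ?_ ?_ ?_]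
    · congr 1
      ext x
      simp only [Set.mem_ofPred_eq, Set.mem_union]
      rw [Nat.le_succ_iff]
      tauto
    · refine Set.disjoint_left.2 fun x h1 h2 => ?_
      have h1 : x.length ≤ n ∧ x ∈ A := h1
      have h2 : x.length = n + 1 ∧ x ∈ A := h2
      omega
    · exact finite_length_le_and A n
    · exact (finite_length_le (n + 1)).subset fun x hx => hx.1.le

theorem ncard_length_le (n : ℕ) : {x : List Bool | x.length ≤ n}.ncard = 2 ^ (n + 1) - 1 := by
  have h := ncard_length_le_and_eq_sum Set.univ n
  simp only [Set.mem_univ, and_true, ncard_length_eq] at h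
  rw [h, Nat.geomSum_eq le_rfl]
  simp

theorem two_pow_le_fraction_denominator (n : ℕ) : (2 : ℝ) ^ n ≤ 2 ^ (n + 1) - 1 := by
  have : (1 : ℝ) ≤ 2 ^ n := one_le_pow₀ (by norm_num)
  rw [pow_succ]
  linarith

theorem fraction_denominator_pos (n : ℕ) : (0 : ℝ) < 2 ^ (n + 1) - 1 :=
  (pow_pos two_pos n).trans_le (two_pow_le_fraction_denominator n)

theorem fraction_nonneg (A : Set (List Bool)) (n : ℕ) : 0 ≤ fraction A n :=
  div_nonneg (Nat.cast_nonneg _) (fraction_denominator_pos n).le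

theorem ncard_add_ncard_compl (A : Set (List Bool)) (n : ℕ) :
    ({x : List Bool | x.length ≤ n ∧ x ∈ A}.ncard : ℝ) +
      {x : List Bool | x.length ≤ n ∧ x ∉ A}.ncard = 2 ^ (n + 1) - 1 := by
  have h : {x : List Bool | x.length ≤ n ∧ x ∈ A}.ncard +
      {x : List Bool | x.length ≤ n ∧ x ∉ A}.ncard = 2 ^ (n + 1) - 1 := by
    rw [← ncard_length_le, ← Set.ncard_union_eq ?_ ?_ ?_]
    · congr 1
      ext x
      simp only [Set.mem_ofPred_eq, Set.mem_union]
      tauto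
    · exact Set.disjoint_left.2 fun x h1 h2 => h2.2 h1.2
    · exact finite_length_le_and A n
    · exact finite_length_le_and Aᶜ n
  have h2 : 1 ≤ 2 ^ (n + 1) := Nat.one_le_two_pow
  have := congrArg (Nat.cast (R := ℝ)) h
  rw [Nat.cast_sub h2] at this
  exact_mod_cast this

/-- A union of finite sets such that the `r`-th one has density at most `2 ^ (-r)` among the
strings of any length has density zero. -/
theorem tendsto_fraction_zero_of_iUnion (T : ℕ → Set (List Bool)) (hfin : ∀ r, (T r).Finite)
    (hT : ∀ r n, {x : List Bool | x.length = n ∧ x ∈ T r}.ncard * 2 ^ r ≤ 2 ^ n) :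
    Tendsto (fraction (⋃ r, T r)) atTop (𝓝 0) := by
  have hle : ∀ r n, {x : List Bool | x.length ≤ n ∧ x ∈ T r}.ncard * 2 ^ r ≤ 2 ^ (n + 1) := by
    intro r n
    rw [ncard_length_le_and_eq_sum, Finset.sum_mul]
    refine (Finset.sum_le_sum fun m _ => hT r m).trans ?_
    rw [Nat.geomSum_eq le_rfl]
    simp
  -- The first `R` sets are finite and fade like `2 ^ (-n)`; the later ones have shares bounded by a
  -- geometric tail.
  have hbound : ∀ R n, fraction (⋃ r, T r) n ≤
      (⋃ r ∈ Finset.range R, T r).ncard / 2 ^ n + 4 / 2 ^ R := by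
    intro R n
    have hsub : {x : List Bool | x.length ≤ n ∧ x ∈ ⋃ r, T r} ⊆
        (⋃ r ∈ Finset.range R, T r) ∪
          ⋃ r ∈ Finset.Ico R (R + (n + 2)), {x : List Bool | x.length ≤ n ∧ x ∈ T r} := by
      rintro x ⟨hx, hxr⟩
      obtain ⟨r, hxr⟩ := Set.mem_iUnion.1 hxr
      by_cases hr : r < R
      · exact Or.inl (Set.mem_biUnion (by simpa using hr) hxr)
      · refine Or.inr (Set.mem_biUnion (Finset.mem_Ico.2 ⟨by omega, ?_⟩) ⟨hx, hxr⟩)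
        -- A nonempty share forces `2 ^ r ≤ 2 ^ (n + 1)`, so only finitely many `r` matter for given
        -- `n`.
        have h1 : 1 ≤ {x : List Bool | x.length ≤ n ∧ x ∈ T r}.ncard :=
          (Set.ncard_pos (finite_length_le_and _ n)).2 ⟨x, hx, hxr⟩
        have h2 := hle r n
        have h3 : 2 ^ r ≤ 2 ^ (n + 1) := le_trans (by nlinarith [Nat.two_pow_pos r]) h2
        have := (Nat.pow_le_pow_iff_right (by norm_num : 1 < 2)).1 h3
        omega
    have hF : (⋃ r ∈ Finset.range R, T r).Finite :=
      (Finset.range R).finite_toSet.biUnion fun r _ => hfin r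
    have h1 := (Set.ncard_le_ncard hsub (hF.union
      ((Finset.Ico R (R + (n + 2))).finite_toSet.biUnion fun r _ =>
        finite_length_le_and _ n))).trans ((Set.ncard_union_le _ _).trans
          (Nat.add_le_add_left (Finset.set_ncard_biUnion_le _ _) _))
    have h2 : ((∑ r ∈ Finset.Ico R (R + (n + 2)),
        {x : List Bool | x.length ≤ n ∧ x ∈ T r}.ncard : ℕ) : ℝ) ≤ 2 ^ n * (4 / 2 ^ R) := by
      push_cast
      have h3 : ∀ r ∈ Finset.Ico R (R + (n + 2)),
          ({x : List Bool | x.length ≤ n ∧ x ∈ T r}.ncard : ℝ) ≤ 2 ^ (n + 1) * (1 / 2) ^ r := by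
        intro r _
        rw [one_div, inv_pow, ← div_eq_mul_inv, le_div_iff₀ (by positivity)]
        exact_mod_cast hle r n
      refine (Finset.sum_le_sum h3).trans ?_
      rw [← Finset.mul_sum, Finset.sum_Ico_eq_sum_range]
      simp only [pow_add, ← Finset.mul_sum, Nat.add_sub_cancel_left]
      have h4 : ∑ i ∈ Finset.range (n + 2), ((1 : ℝ) / 2) ^ i ≤ 2 := by
        rw [geom_sum_eq (by norm_num), div_le_iff_of_neg (by norm_num)]
        have : (0 : ℝ) ≤ (1 / 2) ^ (n + 2) := by positivity
        linarith
      have h5 : (0 : ℝ) < 2 ^ n * (1 / 2) ^ R := by positivity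
      rw [show (2 : ℝ) ^ n * 2 ^ 1 * ((1 / 2) ^ R * ∑ i ∈ Finset.range (n + 2), (1 / 2) ^ i) =
        (2 ^ n * (1 / 2) ^ R) * (2 * ∑ i ∈ Finset.range (n + 2), (1 / 2) ^ i) by ring]
      rw [show (2 : ℝ) ^ n * (4 / 2 ^ R) = (2 ^ n * (1 / 2) ^ R) * 4 by
        rw [one_div, inv_pow]; ring]
      exact mul_le_mul_of_nonneg_left (by linarith) h5.le
    have h3 : ({x : List Bool | x.length ≤ n ∧ x ∈ ⋃ r, T r}.ncard : ℝ) ≤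
        (⋃ r ∈ Finset.range R, T r).ncard + 2 ^ n * (4 / 2 ^ R) := by
      refine le_trans (by exact_mod_cast h1) (add_le_add_right h2 _)
    rw [fraction]
    refine (div_le_div_of_nonneg_left (Nat.cast_nonneg _) (by positivity)
      (two_pow_le_fraction_denominator n)).trans ?_
    rw [div_le_iff₀ (by positivity)]
    refine h3.trans (le_of_eq ?_)
    field_simp
  rw [Metric.tendsto_atTop]
  intro ε hε
  obtain ⟨R, hR⟩ := exists_pow_lt_of_lt_one (show 0 < ε / 8 by positivity)
    (show (1 / 2 : ℝ) < 1 by norm_num)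
  have hlim : Tendsto (fun n => ((⋃ r ∈ Finset.range R, T r).ncard : ℝ) * (1 / 2) ^ n) atTop
      (𝓝 0) := by
    simpa using (tendsto_pow_atTop_nhds_zero_of_lt_one (by norm_num : (0 : ℝ) ≤ 1 / 2)
      (by norm_num)).const_mul ((⋃ r ∈ Finset.range R, T r).ncard : ℝ)
  obtain ⟨n₀, hn₀⟩ := eventually_atTop.1 (hlim.eventually (gt_mem_nhds (half_pos hε)))
  refine ⟨n₀, fun n hn => ?_⟩
  rw [Real.dist_0_eq_abs, abs_of_nonneg (fraction_nonneg _ _)]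
  have h1 := hn₀ n hn
  have h2 := hbound R n
  rw [one_div, inv_pow, ← div_eq_mul_inv] at h1
  rw [one_div, inv_pow] at hR
  rw [div_eq_mul_inv 4] at h2
  linarith

/-! ### Computations with finite oracle prefixes -/

/-- The algorithm with program `next` outputs `b` on input `a`, reading only bits of `σ`. -/
def OutputsOn {α β : Type} (next : α × List Bool →. Option β) (σ : List Bool) (a : α) (b : β) :
    Prop :=
  ∃ k ≤ σ.length, some b ∈ next (a, σ.take k) ∧ ∀ j < k, none ∈ next (a, σ.take j)

theorem mem_run_iff_outputsOn {α β : Type} [Primcodable α] [Primcodable β]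
    {Γ : RandomizedAlgorithm α β} {X : ℕ → Bool} {a : α} {b : β} :
    b ∈ Γ.run X a ↔ ∃ n, OutputsOn Γ.next (bitPrefix X n) a b := by
  rw [RandomizedAlgorithm.mem_run]
  constructor
  · rintro ⟨k, hk, h⟩
    exact ⟨k, k, (length_bitPrefix X k).ge, by rwa [take_bitPrefix X le_rfl],
      fun j hj => by rw [take_bitPrefix X hj.le]; exact h j hj⟩
  · rintro ⟨n, k, hkn, hk, h⟩
    rw [length_bitPrefix] at hkn
    rw [take_bitPrefix X hkn] at hk
    exact ⟨k, hk, fun j hj => by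
      have := h j hj
      rwa [take_bitPrefix X (hj.le.trans hkn)] at this⟩

theorem OutputsOn.mono {α β : Type} {next : α × List Bool →. Option β} {X : ℕ → Bool} {m n : ℕ}
    (hmn : m ≤ n) {a : α} {b : β} (h : OutputsOn next (bitPrefix X m) a b) :
    OutputsOn next (bitPrefix X n) a b := by
  obtain ⟨k, hk, h1, h2⟩ := h
  rw [length_bitPrefix] at hk
  refine ⟨k, by rw [length_bitPrefix]; omega, ?_, fun j hj => ?_⟩
  · rw [take_bitPrefix X hk] at h1
    rwa [take_bitPrefix X (hk.trans hmn)]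
  · have := h2 j hj
    rw [take_bitPrefix X (by omega)] at this
    rwa [take_bitPrefix X (by omega)]

/-- The parameter in `γ` allows the simple set to be built against all codes of algorithms at once.
-/
theorem OutputsOn.re {γ α β : Type} [Primcodable γ] [Primcodable α] [Primcodable β]
    {next : γ → α × List Bool →. Option β} (hnext : Partrec₂ next) :
    REPred fun x : (γ × List Bool) × (α × β) => OutputsOn (next x.1.1) x.1.2 x.2.1 x.2.2 := by
  have h : REPred fun x : ((γ × List Bool) × (α × β)) × ℕ => x.2 ≤ x.1.1.2.length ∧
      some x.1.2.2 ∈ next x.1.1.1 (x.1.2.1, x.1.1.2.take x.2) ∧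
        ∀ j ∈ List.range x.2, none ∈ next x.1.1.1 (x.1.2.1, x.1.1.2.take j) := by
    refine REPred.and (PrimrecPred.to_re ?_) (REPred.and ?_ ?_)
    · exact Primrec.nat_le.comp Primrec.snd (Primrec.list_length.comp
        (Primrec.snd.comp (Primrec.fst.comp Primrec.fst)))
    · refine Partrec.re_mem_comp (f := fun y : γ × (α × List Bool) => next y.1 y.2)
        (g := fun x : ((γ × List Bool) × (α × β)) × ℕ =>
          (x.1.1.1, (x.1.2.1, x.1.1.2.take x.2))) (h := fun x => some x.1.2.2) hnext
        (Primrec.to_comp ?_) (Primrec.to_comp ?_)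
      · exact (Primrec.fst.comp (Primrec.fst.comp Primrec.fst)).pair
          ((Primrec.fst.comp (Primrec.snd.comp Primrec.fst)).pair
            (Primrec.list_take.comp Primrec.snd
              (Primrec.snd.comp (Primrec.fst.comp Primrec.fst))))
      · exact Primrec.option_some.comp (Primrec.snd.comp (Primrec.snd.comp Primrec.fst))
    · refine REPred.forall_mem_list (p := fun (x : ((γ × List Bool) × (α × β)) × ℕ) j =>
        none ∈ next x.1.1.1 (x.1.2.1, x.1.1.2.take j)) ?_
        (Primrec.list_range.comp Primrec.snd).to_comp
      refine Partrec.re_mem_comp (f := fun y : γ × (α × List Bool) => next y.1 y.2)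
        (g := fun x : (((γ × List Bool) × (α × β)) × ℕ) × ℕ =>
          (x.1.1.1.1, (x.1.1.2.1, x.1.1.1.2.take x.2))) (h := fun x => none) hnext
        (Primrec.to_comp ?_) (Computable.const none)
      exact (Primrec.fst.comp (Primrec.fst.comp (Primrec.fst.comp Primrec.fst))).pair
        ((Primrec.fst.comp (Primrec.snd.comp (Primrec.fst.comp Primrec.fst))).pair
          (Primrec.list_take.comp Primrec.snd
            (Primrec.snd.comp (Primrec.fst.comp (Primrec.fst.comp Primrec.fst)))))
  refine (REPred.exists (p := fun (x : (γ × List Bool) × (α × β)) k => k ≤ x.1.2.length ∧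
      some x.2.2 ∈ next x.1.1 (x.2.1, x.1.2.take k) ∧
        ∀ j ∈ List.range k, none ∈ next x.1.1 (x.2.1, x.1.2.take j)) h).of_eq fun x => ?_
  simp [OutputsOn]

/-- The partial function with a given code. -/
def codeFunction {α β : Type} [Primcodable α] [Primcodable β] (c : Nat.Partrec.Code) : α →. β :=
  fun a => (c.eval (Encodable.encode a)).bind fun n => (Encodable.decode (α := β) n : Part β)

theorem partrec_codeFunction {α β : Type} [Primcodable α] [Primcodable β] :
    Partrec₂ (codeFunction : Nat.Partrec.Code → α →. β) :=
  Partrec.bind (Nat.Partrec.Code.eval_part.comp Computable.fst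
    (Computable.encode.comp Computable.snd))
    (Computable.ofOption (Computable.decode.comp Computable.snd))

theorem exists_codeFunction_eq {α β : Type} [Primcodable α] [Primcodable β] {f : α →. β}
    (hf : Partrec f) : ∃ c, codeFunction c = f := by
  obtain ⟨c, hc⟩ := Nat.Partrec.Code.exists_code.1 hf
  refine ⟨c, funext fun a => ?_⟩
  rw [codeFunction, hc]
  simp [Part.bind_map, Part.bind_some_right]

/-! ### A sparse simple set for randomized algorithms -/

theorem measure_le_of_subset_iUnion_monotone {Ω : Type*} [MeasurableSpace Ω] {μ : Measure Ω}
    {G : Set Ω} {s : ℕ → Set Ω} (hs : Monotone s) (hG : G ⊆ ⋃ n, s n) {c : ENNReal}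
    (hc : ∀ n, μ (s n) ≤ c) : μ G ≤ c :=
  (measure_mono hG).trans (hs.measure_iUnion.le.trans (iSup_le hc))

/-- The lengths below this threshold have been dealt with by the actions `H`, an action being a
prefix together with the next threshold. -/
def nextThreshold (r : ℕ) (H : List (List Bool × ℕ)) : ℕ :=
  (H.head?.map Prod.snd).getD r

/-- The oracle prefix `σ` makes the algorithm with code `c` enumerate an extension of `b.1` whose
length is less than `b.2` but not less than the current threshold. -/
def SupportsPrefix (r : ℕ) (H : List (List Bool × ℕ)) (b : List Bool × ℕ) (σ : List Bool) :
    Prop :=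
  b.1.length = r ∧ ∃ y : ℕ × List Bool,
    OutputsOn (codeFunction (Denumerable.ofNat Nat.Partrec.Code r.unpair.1)) σ y.1 y.2 ∧
      nextThreshold r H ≤ y.2.length ∧ y.2.length < b.2 ∧ b.1 <+: y.2

theorem primrec_nextThreshold : Primrec₂ nextThreshold :=
  Primrec.option_getD.comp (Primrec.option_map (Primrec.list_head?.comp Primrec.snd)
    (Primrec.snd.comp Primrec.snd).to₂) Primrec.fst

theorem PrimrecRel.list_prefix : PrimrecRel fun l₁ l₂ : List Bool => l₁ <+: l₂ :=
  (Primrec.eq.comp Primrec.fst (Primrec.list_take.comp (Primrec.list_length.comp Primrec.fst)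
    Primrec.snd)).of_eq fun _ => List.prefix_iff_eq_take.symm

theorem SupportsPrefix.re :
    REPred fun x : ((ℕ × List (List Bool × ℕ)) × (List Bool × ℕ)) × List Bool =>
      SupportsPrefix x.1.1.1 x.1.1.2 x.1.2 x.2 := by
  refine REPred.and (PrimrecPred.to_re ?_) ?_
  · exact Primrec.eq.comp (Primrec.list_length.comp (Primrec.fst.comp
      (Primrec.snd.comp Primrec.fst))) (Primrec.fst.comp (Primrec.fst.comp Primrec.fst))
  · refine REPred.exists
      (p := fun (x : ((ℕ × List (List Bool × ℕ)) × (List Bool × ℕ)) × List Bool)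
        (y : ℕ × List Bool) =>
        OutputsOn (codeFunction (Denumerable.ofNat Nat.Partrec.Code x.1.1.1.unpair.1)) x.2 y.1 y.2 ∧
        nextThreshold x.1.1.1 x.1.1.2 ≤ y.2.length ∧ y.2.length < x.1.2.2 ∧ x.1.2.1 <+: y.2) ?_
    refine REPred.and ?_ (PrimrecPred.to_re (PrimrecPred.and ?_ (PrimrecPred.and ?_ ?_)))
    · let f : (((ℕ × List (List Bool × ℕ)) × (List Bool × ℕ)) × List Bool) × (ℕ × List Bool) →
          (Nat.Partrec.Code × List Bool) × (ℕ × List Bool) := fun x =>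
        ((Denumerable.ofNat Nat.Partrec.Code x.1.1.1.1.unpair.1, x.1.2), x.2)
      have hf : Primrec f := by
        refine Primrec.pair (Primrec.pair ?_ (Primrec.snd.comp Primrec.fst)) Primrec.snd
        exact (Primrec.ofNat _).comp (Primrec.fst.comp (Primrec.unpair.comp
          (Primrec.fst.comp (Primrec.fst.comp (Primrec.fst.comp Primrec.fst)))))
      exact REPred.comp (OutputsOn.re (α := ℕ) (β := List Bool) partrec_codeFunction)
        (f := f) hf.to_comp
    · exact Primrec.nat_le.comp (primrec_nextThreshold.comp
        (Primrec.fst.comp (Primrec.fst.comp (Primrec.fst.comp Primrec.fst)))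
        (Primrec.snd.comp (Primrec.fst.comp (Primrec.fst.comp Primrec.fst))))
        (Primrec.list_length.comp (Primrec.snd.comp Primrec.snd))
    · exact Primrec.nat_lt.comp (Primrec.list_length.comp (Primrec.snd.comp Primrec.snd))
        (Primrec.snd.comp (Primrec.snd.comp (Primrec.fst.comp Primrec.fst)))
    · exact PrimrecRel.list_prefix.comp
        (Primrec.fst.comp (Primrec.snd.comp (Primrec.fst.comp Primrec.fst)))
        (Primrec.snd.comp Primrec.snd)

theorem ncard_prefix_le (τ : List Bool) (n : ℕ) :
    {x : List Bool | x.length = n ∧ τ <+: x}.ncard * 2 ^ τ.length ≤ 2 ^ n := by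
  by_cases h : τ.length ≤ n
  · have h1 : {x : List Bool | x.length = n ∧ τ <+: x}.ncard ≤ 2 ^ (n - τ.length) := by
      rw [← ncard_length_eq (n - τ.length)]
      refine (Set.ncard_le_ncard (t := (τ ++ ·) '' {x : List Bool | x.length = n - τ.length})
        ?_ ((List.finite_length_eq Bool _).image _)).trans
          (Set.ncard_image_le (List.finite_length_eq Bool _))
      rintro x ⟨hx, y, rfl⟩
      refine ⟨y, ?_, rfl⟩
      rw [List.length_append] at hx
      simp only [Set.mem_ofPred_eq]
      omega
    refine (Nat.mul_le_mul_right _ h1).trans ?_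
    rw [← pow_add, Nat.sub_add_cancel h]
  · have h1 : {x : List Bool | x.length = n ∧ τ <+: x} = ∅ := by
      ext x
      simp only [Set.mem_ofPred_eq, Set.mem_empty_iff_false, iff_false, not_and]
      intro hx hτ
      have := hτ.length_le
      omega
    simp [h1]

/-- There is an enumerable set of density zero such that almost surely a randomized algorithm
does not enumerate an infinite subset of its complement. -/
theorem exists_sparse_simple_set : ∃ S : Set (List Bool), REPred (fun x => x ∈ S) ∧
    Tendsto (fraction S) atTop (𝓝 0) ∧
    ∀ Γ : RandomizedAlgorithm ℕ (List Bool),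
      coinMeasure {X | (Γ.enumerated X).Infinite ∧ Γ.enumerated X ⊆ Sᶜ} = 0 := by
  classical
  -- The measure bound `2 ^ (-2 * r)` leaves `2 ^ (-r)` after summation over the `2 ^ r` prefixes of
  -- length `r`.
  obtain ⟨Hist, hre, hHist⟩ := exists_diagonalization SupportsPrefix.re
    (k := fun r => 2 * r) Primrec.nat_double
  -- Each action absorbs the enumerated strings that justified it, so the supporting oracles no
  -- longer enumerate a subset of the complement.
  let T : ℕ → Set (List Bool) := fun r => {x | ∃ y : (List Bool × ℕ) × List (List Bool × ℕ),
    Hist r (y.1 :: y.2) ∧ nextThreshold r y.2 ≤ x.length ∧ x.length < y.1.2 ∧ y.1.1 <+: x}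
  -- Thresholds grow along the history, since a supporting string is at least as long as the old
  -- threshold and shorter than the new one.
  have hthr : ∀ r Hmax, (∀ l b, b :: l <:+ Hmax → ∃ σ, SupportsPrefix r l b σ) →
      ∀ m, m <:+ Hmax → r ≤ nextThreshold r m ∧
        ∀ b l, b :: l <:+ m → b.2 ≤ nextThreshold r m := by
    intro r Hmax hsup m
    induction m with
    | nil => exact fun _ => ⟨by simp [nextThreshold], fun b l h => by simp at h⟩
    | cons a m ih =>
      intro hm
      obtain ⟨h1, h2⟩ := ih ((List.suffix_cons a m).trans hm)
      obtain ⟨σ, -, y, -, h3, h4, -⟩ := hsup m a hm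
      have h5 : nextThreshold r (a :: m) = a.2 := rfl
      refine ⟨by omega, fun b l h => ?_⟩
      rcases List.suffix_cons_iff.1 h with e | h
      · obtain ⟨rfl, rfl⟩ := List.cons_eq_cons.1 e
        exact h5.ge
      · have := h2 b l h
        omega
  refine ⟨⋃ r, T r, ?_, tendsto_fraction_zero_of_iUnion T (fun r => ?_) (fun r n => ?_), ?_⟩
  · refine (REPred.exists (p := fun (x : List Bool) (r : ℕ) => x ∈ T r) ?_).of_eq
      fun x => by simp
    refine REPred.exists (p := fun (x : List Bool × ℕ)
      (y : (List Bool × ℕ) × List (List Bool × ℕ)) =>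
      Hist x.2 (y.1 :: y.2) ∧ nextThreshold x.2 y.2 ≤ x.1.length ∧ x.1.length < y.1.2 ∧
        y.1.1 <+: x.1) ?_
    refine REPred.and ?_ (PrimrecPred.to_re (PrimrecPred.and ?_ (PrimrecPred.and ?_ ?_)))
    · let f : (List Bool × ℕ) × ((List Bool × ℕ) × List (List Bool × ℕ)) →
          ℕ × List (List Bool × ℕ) := fun x => (x.1.2, x.2.1 :: x.2.2)
      have hf : Primrec f := (Primrec.snd.comp Primrec.fst).pair
        (Primrec.list_cons.comp (Primrec.fst.comp Primrec.snd) (Primrec.snd.comp Primrec.snd))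
      exact REPred.comp hre (f := f) hf.to_comp
    · exact Primrec.nat_le.comp (primrec_nextThreshold.comp (Primrec.snd.comp Primrec.fst)
        (Primrec.snd.comp Primrec.snd)) (Primrec.list_length.comp (Primrec.fst.comp Primrec.fst))
    · exact Primrec.nat_lt.comp (Primrec.list_length.comp (Primrec.fst.comp Primrec.fst))
        (Primrec.snd.comp (Primrec.fst.comp Primrec.snd))
    · exact PrimrecRel.list_prefix.comp (Primrec.fst.comp (Primrec.fst.comp Primrec.snd))
        (Primrec.fst.comp Primrec.fst)
  · obtain ⟨Hmax, K, -, -, hsuf, hlegal, -, -⟩ := hHist r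
    refine (finite_length_le (nextThreshold r Hmax)).subset ?_
    rintro x ⟨⟨b, l⟩, hh, -, hlt, -⟩
    have := (hthr r Hmax (fun l b h => (hlegal l b h).2) Hmax List.suffix_rfl).2 b l (hsuf _ hh)
    exact hlt.le.trans this
  · obtain ⟨Hmax, K, -, -, hsuf, hlegal, -, -⟩ := hHist r
    have hthr' := hthr r Hmax fun l b h => (hlegal l b h).2
    by_cases hne : {x : List Bool | x.length = n ∧ x ∈ T r} = ∅
    · simp [hne]
    obtain ⟨x, hx, ⟨b, l⟩, hb, hb1, hb2, hb3⟩ := Set.nonempty_iff_ne_empty.2 hne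
    obtain ⟨σ, hlen, -⟩ := (hlegal l b (hsuf _ hb)).2
    refine le_trans (Nat.mul_le_mul_right _ (Set.ncard_le_ncard ?_
      ((List.finite_length_eq Bool n).subset fun x hx => hx.1)))
      (hlen ▸ ncard_prefix_le b.1 n)
    rintro x' ⟨hx', ⟨b', l'⟩, hb', hb1', hb2', hb3'⟩
    refine ⟨hx', ?_⟩
    simp only at hb1 hb2 hb3 hb1' hb2' hb3' hb hb'
    rw [hx] at hb1 hb2
    rw [hx'] at hb1' hb2'
    -- Different actions use disjoint intervals of lengths, so at length `n` all of `T r` comes from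
    -- a single prefix of length `r`, which gives density at most `2 ^ (-r)`.
    suffices b :: l = b' :: l' by
      obtain ⟨rfl, rfl⟩ := List.cons_eq_cons.1 this
      exact hb3'
    have hs := hsuf _ hb
    have hs' := hsuf _ hb'
    rcases List.suffix_or_suffix_of_suffix hs hs' with h | h
    · rcases List.suffix_cons_iff.1 h with e | h
      · exact e
      · have := (hthr' l' ((List.suffix_cons b' l').trans hs')).2 b l h
        omega
    · rcases List.suffix_cons_iff.1 h with e | h
      · exact e.symm
      · have := (hthr' l ((List.suffix_cons b l).trans hs)).2 b' l' h
        omega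
  · intro Γ
    set G := {X | (Γ.enumerated X).Infinite ∧ Γ.enumerated X ⊆ (⋃ r, T r)ᶜ} with hG
    obtain ⟨c, hc⟩ := exists_codeFunction_eq Γ.partrec_next
    have key : ∀ t : ℕ, coinMeasure G ≤ (2⁻¹ : ENNReal) ^ t := by
      intro t
      -- Pairing with `t` gives the same algorithm infinitely many games with arbitrarily small
      -- measure bounds.
      set r := Nat.pair (Encodable.encode c) t with hr
      have htr : t ≤ r := Nat.right_le_pair _ _
      have hcode : codeFunction (Denumerable.ofNat Nat.Partrec.Code r.unpair.1) = Γ.next := by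
        rw [hr, Nat.unpair_pair, Denumerable.ofNat_encode, hc]
      obtain ⟨Hmax, K, -, -, hsuf, hlegal, hK, hlast⟩ := hHist r
      have hdisj : Disjoint G K := by
        refine Set.disjoint_left.2 fun X hX hXK => ?_
        obtain ⟨l, b, n, hbl, -, y, hy, h1, h2, h3⟩ := hK X hXK
        rw [hcode] at hy
        exact hX.2 ⟨y.1, mem_run_iff_outputsOn.2 ⟨n, hy⟩⟩
          (Set.mem_iUnion.2 ⟨r, (b, l), (hlegal l b hbl).1, h1, h2, h3⟩)
      let Gτ : List Bool → ℕ → Set (ℕ → Bool) := fun τ L =>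
        {X ∈ G | ∃ x ∈ Γ.enumerated X, nextThreshold r Hmax ≤ x.length ∧ x.length < L ∧ τ <+: x}
      have hGτ : ∀ τ ∈ {τ : List Bool | τ.length = r}, ∀ L,
          coinMeasure (Gτ τ L) ≤ (2 ^ (2 * r))⁻¹ := by
        intro τ hτ L
        refine hlast (τ, L) (Gτ τ L) (hdisj.mono_left fun X hX => hX.1) ?_
        rintro X ⟨-, x, ⟨i, hx⟩, h1, h2, h3⟩
        obtain ⟨n, hn⟩ := mem_run_iff_outputsOn.1 hx
        exact ⟨n, hτ, (i, x), by rw [hcode]; exact hn, h1, h2, h3⟩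
      have hfin : {τ : List Bool | τ.length = r}.Finite := List.finite_length_eq Bool r
      have hcover : G ⊆ ⋃ τ ∈ hfin.toFinset, ⋃ L, Gτ τ L := by
        intro X hX
        obtain ⟨x, hx, hxl⟩ : ∃ x ∈ Γ.enumerated X, nextThreshold r Hmax < x.length := by
          by_contra! h
          exact hX.1 ((finite_length_le _).subset h)
        have h1 := (hthr r Hmax (fun l b h => (hlegal l b h).2) Hmax List.suffix_rfl).1
        refine Set.mem_biUnion (x := x.take r) ?_ (Set.mem_iUnion.2 ⟨x.length + 1, hX, x, hx,
          hxl.le, by omega, List.take_prefix _ _⟩)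
        simp only [Set.Finite.coe_toFinset, Set.mem_ofPred_eq, List.length_take]
        omega
      calc coinMeasure G ≤ ∑ τ ∈ hfin.toFinset, coinMeasure (⋃ L, Gτ τ L) :=
            (measure_mono hcover).trans (measure_biUnion_finset_le _ _)
        _ ≤ ∑ τ ∈ hfin.toFinset, ((2 : ENNReal) ^ (2 * r))⁻¹ := by
            refine Finset.sum_le_sum fun τ hτ => ?_
            refine measure_le_of_subset_iUnion_monotone ?_ subset_rfl (hGτ τ (by simpa using hτ))
            exact fun L L' hL X hX =>
              ⟨hX.1, hX.2.imp fun x hx => ⟨hx.1, hx.2.1, hx.2.2.1.trans_le hL, hx.2.2.2⟩⟩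
        _ = 2 ^ r * ((2 : ENNReal) ^ (2 * r))⁻¹ := by
            rw [Finset.sum_const, ← Set.ncard_eq_toFinset_card _ hfin, ncard_length_eq]
            simp
        _ = (2⁻¹ : ENNReal) ^ r := by
            rw [two_mul, pow_add, ENNReal.mul_inv (by simp) (by simp), ← mul_assoc,
              ENNReal.mul_inv_cancel (by simp) (by simp), one_mul, ENNReal.inv_pow]
        _ ≤ (2⁻¹ : ENNReal) ^ t := pow_le_pow_of_le_one (by simp) (by simp) htr
    have hlim : Tendsto (fun t : ℕ => (2⁻¹ : ENNReal) ^ t) atTop (𝓝 0) :=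
      ENNReal.tendsto_pow_atTop_nhds_zero_of_lt_one (by simp)
    exact le_antisymm (ge_of_tendsto' hlim key) (zero_le)

/-! ### Domains of upper density one -/

/-- With oracle prefix `σ` the program `next` gives answers for all but about `2 ^ (n + 1 - 2 * j)`
of the strings of length at most `n`, for some entry `(n, Z)` of `b`, and no string for which the
answer is `true` is a description of an element of `Z`; the set `Z` has more than
`2 ^ (n + 1 - 2 * j)` elements. -/
def SupportsClaim (U : List Bool →. List Bool) (next : List Bool × List Bool →. Option Bool)
    (j : ℕ) (b : List (ℕ × List (List Bool))) (σ : List Bool) : Prop :=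
  (b.map Prod.fst).Nodup ∧ ∃ y : (ℕ × List (List Bool)) × List (List Bool), y.1 ∈ b ∧
    (2 * j ≤ y.1.1 ∧ y.1.2.Nodup ∧ y.1.2.length = 2 ^ (y.1.1 + 1 - 2 * j) + 1) ∧
    (y.2.Nodup ∧ 2 ^ (y.1.1 + 1) ≤ y.2.length + 2 ^ (y.1.1 + 1 - 2 * j) + 1) ∧
    ∀ x ∈ y.2, x.length ≤ y.1.1 ∧ (OutputsOn next σ x false ∨
      (OutputsOn next σ x true ∧ ∃ z, z ∈ U x ∧ z ∉ y.1.2))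

theorem OutputsOn.re_comp {δ α β : Type} [Primcodable δ] [Primcodable α] [Primcodable β]
    {next : α × List Bool →. Option β} (hnext : Partrec next) {s : δ → List Bool} {f : δ → α}
    {g : δ → β} (hs : Computable s) (hf : Computable f) (hg : Computable g) :
    REPred fun x => OutputsOn next (s x) (f x) (g x) := by
  have h : Partrec₂ fun (_ : Unit) (x : α × List Bool) => next x := hnext.comp Computable.snd
  exact REPred.comp (OutputsOn.re h) (f := fun x => (((), s x), (f x, g x)))
    (((Computable.const ()).pair hs).pair (hf.pair hg))

theorem SupportsClaim.re {U : List Bool →. List Bool} (hU : Partrec U)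
    {next : List Bool × List Bool →. Option Bool} (hnext : Partrec next) :
    REPred fun x : ((ℕ × List (List (ℕ × List (List Bool)))) × List (ℕ × List (List Bool))) ×
      List Bool => SupportsClaim U next x.1.1.1 x.1.2 x.2 := by
  let A := (ℕ × List (List (ℕ × List (List Bool)))) × List (ℕ × List (List Bool))
  let Y := (ℕ × List (List Bool)) × List (List Bool)
  have hj : Primrec fun x : (A × List Bool) × Y => x.1.1.1.1 :=
    Primrec.fst.comp (Primrec.fst.comp (Primrec.fst.comp Primrec.fst))
  have hn : Primrec fun x : (A × List Bool) × Y => x.2.1.1 :=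
    Primrec.fst.comp (Primrec.fst.comp Primrec.snd)
  have hZ : Primrec fun x : (A × List Bool) × Y => x.2.1.2 :=
    Primrec.snd.comp (Primrec.fst.comp Primrec.snd)
  have hD : Primrec fun x : (A × List Bool) × Y => x.2.2 := Primrec.snd.comp Primrec.snd
  have h2j : Primrec fun x : (A × List Bool) × Y => 2 * x.1.1.1.1 := Primrec.nat_double.comp hj
  have hn1 : Primrec fun x : (A × List Bool) × Y => x.2.1.1 + 1 := Primrec.succ.comp hn
  have hpow : Primrec fun x : (A × List Bool) × Y => 2 ^ (x.2.1.1 + 1 - 2 * x.1.1.1.1) :=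
    Primrec.nat_pow.comp (Primrec.const 2) (Primrec.nat_sub.comp hn1 h2j)
  refine REPred.and (PrimrecPred.to_re ?_) ?_
  · have h : Primrec fun b : List (ℕ × List (List Bool)) => b.map Prod.fst :=
      Primrec.list_map Primrec.id (Primrec.fst.comp Primrec.snd).to₂
    exact PrimrecPred.list_nodup.comp (h.comp (Primrec.snd.comp Primrec.fst))
  · refine REPred.exists (p := fun (x : A × List Bool) (y : Y) => y.1 ∈ x.1.2 ∧
      (2 * x.1.1.1 ≤ y.1.1 ∧ y.1.2.Nodup ∧ y.1.2.length = 2 ^ (y.1.1 + 1 - 2 * x.1.1.1) + 1) ∧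
      (y.2.Nodup ∧ 2 ^ (y.1.1 + 1) ≤ y.2.length + 2 ^ (y.1.1 + 1 - 2 * x.1.1.1) + 1) ∧
      ∀ s ∈ y.2, s.length ≤ y.1.1 ∧ (OutputsOn next x.2 s false ∨
        (OutputsOn next x.2 s true ∧ ∃ z, z ∈ U s ∧ z ∉ y.1.2))) ?_
    refine REPred.and (PrimrecPred.to_re ?_) (REPred.and (PrimrecPred.to_re ?_)
      (REPred.and (PrimrecPred.to_re ?_) ?_))
    · exact PrimrecRel.list_mem.comp (Primrec.fst.comp Primrec.snd)
        (Primrec.snd.comp (Primrec.fst.comp Primrec.fst))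
    · exact PrimrecPred.and (Primrec.nat_le.comp h2j hn) (PrimrecPred.and
        (PrimrecPred.list_nodup.comp hZ) (Primrec.eq.comp (Primrec.list_length.comp hZ)
          (Primrec.succ.comp hpow)))
    · exact PrimrecPred.and (PrimrecPred.list_nodup.comp hD) (Primrec.nat_le.comp
        (Primrec.nat_pow.comp (Primrec.const 2) hn1)
        (Primrec.succ.comp (Primrec.nat_add.comp (Primrec.list_length.comp hD) hpow)))
    · have hσ : Computable fun x : ((A × List Bool) × Y) × List Bool => x.1.1.2 :=
        Computable.snd.comp (Computable.fst.comp Computable.fst)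
      have hlen : PrimrecPred fun x : ((A × List Bool) × Y) × List Bool =>
          x.2.length ≤ x.1.2.1.1 :=
        Primrec.nat_le.comp (Primrec.list_length.comp Primrec.snd) (hn.comp Primrec.fst)
      have hval : REPred fun x : ((A × List Bool) × Y) × List Bool =>
          ∃ z, z ∈ U x.2 ∧ z ∉ x.1.2.1.2 := by
        refine REPred.exists (p := fun (x : ((A × List Bool) × Y) × List Bool) z =>
          z ∈ U x.2 ∧ z ∉ x.1.2.1.2) (REPred.and ?_ (PrimrecPred.to_re (PrimrecPred.not ?_)))
        · exact hU.re_mem_comp (Computable.snd.comp Computable.fst) Computable.snd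
        · exact PrimrecRel.list_mem.comp Primrec.snd
            (hZ.comp (Primrec.fst.comp Primrec.fst))
      have hans : REPred fun x : ((A × List Bool) × Y) × List Bool =>
          x.2.length ≤ x.1.2.1.1 ∧ (OutputsOn next x.1.1.2 x.2 false ∨
            (OutputsOn next x.1.1.2 x.2 true ∧ ∃ z, z ∈ U x.2 ∧ z ∉ x.1.2.1.2)) :=
        REPred.and hlen.to_re (REPred.or
          (OutputsOn.re_comp hnext hσ Computable.snd (Computable.const false))
          (REPred.and (OutputsOn.re_comp hnext hσ Computable.snd (Computable.const true)) hval))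
      exact REPred.forall_mem_list (f := fun x : (A × List Bool) × Y => x.2.2)
        (p := fun (x : (A × List Bool) × Y) s => s.length ≤ x.2.1.1 ∧
          (OutputsOn next x.1.2 s false ∨
            (OutputsOn next x.1.2 s true ∧ ∃ z, z ∈ U s ∧ z ∉ x.2.1.2))) hans hD.to_comp

/-- The strings assigned, during the play of parameter `j`, to programs of a length `m`
such that `2 ^ m` is an upper bound for their number. -/
def Assigned (Hist : ℕ → List (List (ℕ × List (List Bool))) → Prop) (k : ℕ) (i : ℕ × ℕ)
    (z : List Bool) : Prop :=
  ∃ y : (List (ℕ × List (List Bool)) × List (List (ℕ × List (List Bool)))) ×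
      (ℕ × List (List Bool)),
    Hist i.1 (y.1.1 :: y.1.2) ∧ y.2 ∈ y.1.1 ∧ z ∈ y.2.2 ∧
      2 * i.1 ≤ y.2.1 ∧ y.2.1 + 2 + k = i.2 + 2 * i.1 ∧
      y.2.2.length = 2 ^ (y.2.1 + 1 - 2 * i.1) + 1

theorem Assigned.re {Hist : ℕ → List (List (ℕ × List (List Bool))) → Prop}
    (hre : REPred fun x : ℕ × List (List (ℕ × List (List Bool))) => Hist x.1 x.2) (k : ℕ) :
    REPred fun x : (ℕ × ℕ) × List Bool => Assigned Hist k x.1 x.2 := by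
  let Y := (List (ℕ × List (List Bool)) × List (List (ℕ × List (List Bool)))) ×
    (ℕ × List (List Bool))
  have hj : Primrec fun x : ((ℕ × ℕ) × List Bool) × Y => x.1.1.1 :=
    Primrec.fst.comp (Primrec.fst.comp Primrec.fst)
  have hn : Primrec fun x : ((ℕ × ℕ) × List Bool) × Y => x.2.2.1 :=
    Primrec.fst.comp (Primrec.snd.comp Primrec.snd)
  have hZ : Primrec fun x : ((ℕ × ℕ) × List Bool) × Y => x.2.2.2 :=
    Primrec.snd.comp (Primrec.snd.comp Primrec.snd)
  have h2j : Primrec fun x : ((ℕ × ℕ) × List Bool) × Y => 2 * x.1.1.1 :=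
    Primrec.nat_double.comp hj
  refine REPred.exists (p := fun (x : (ℕ × ℕ) × List Bool) (y : Y) =>
    Hist x.1.1 (y.1.1 :: y.1.2) ∧ y.2 ∈ y.1.1 ∧ x.2 ∈ y.2.2 ∧
      2 * x.1.1 ≤ y.2.1 ∧ y.2.1 + 2 + k = x.1.2 + 2 * x.1.1 ∧
      y.2.2.length = 2 ^ (y.2.1 + 1 - 2 * x.1.1) + 1) ?_
  refine REPred.and ?_ (PrimrecPred.to_re (PrimrecPred.and ?_ (PrimrecPred.and ?_
    (PrimrecPred.and ?_ (PrimrecPred.and ?_ ?_)))))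
  · let f : ((ℕ × ℕ) × List Bool) × Y → ℕ × List (List (ℕ × List (List Bool))) :=
      fun x => (x.1.1.1, x.2.1.1 :: x.2.1.2)
    have hf : Primrec f := hj.pair (Primrec.list_cons.comp
      (Primrec.fst.comp (Primrec.fst.comp Primrec.snd))
      (Primrec.snd.comp (Primrec.fst.comp Primrec.snd)))
    exact REPred.comp hre (f := f) hf.to_comp
  · exact PrimrecRel.list_mem.comp (Primrec.snd.comp Primrec.snd)
      (Primrec.fst.comp (Primrec.fst.comp Primrec.snd))
  · exact PrimrecRel.list_mem.comp (Primrec.snd.comp Primrec.fst) hZ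
  · exact Primrec.nat_le.comp h2j hn
  · exact Primrec.eq.comp (Primrec.nat_add.comp (Primrec.nat_add.comp hn (Primrec.const 2))
      (Primrec.const k)) (Primrec.nat_add.comp
        (Primrec.snd.comp (Primrec.fst.comp Primrec.fst)) h2j)
  · exact Primrec.eq.comp (Primrec.list_length.comp hZ) (Primrec.succ.comp
      (Primrec.nat_pow.comp (Primrec.const 2) (Primrec.nat_sub.comp (Primrec.succ.comp hn) h2j)))

/-- The pair `i = (j, m)` determines `n`, and an action has at most one entry for each `n`. So each
of the at most `2 ^ k` actions contributes at most one `Z`, with `2 ^ (n + 1 - 2j) + 1 ≤ 2 ^ (m -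
k)` elements. -/
theorem Assigned.ncard_le {Hist : ℕ → List (List (ℕ × List (List Bool))) → Prop} {k : ℕ}
    {i : ℕ × ℕ} {Hmax : List (List (ℕ × List (List Bool)))} (hlen : Hmax.length ≤ 2 ^ k)
    (hsuf : ∀ l, Hist i.1 l → l <:+ Hmax) (hnd : ∀ b ∈ Hmax, (b.map Prod.fst).Nodup) :
    {z | Assigned Hist k i z}.Finite ∧ {z | Assigned Hist k i z}.ncard ≤ 2 ^ i.2 := by
  classical
  let S : List (ℕ × List (List Bool)) → Set (List Bool) := fun b =>
    {z | ∃ y ∈ b, z ∈ y.2 ∧ 2 * i.1 ≤ y.1 ∧ y.1 + 2 + k = i.2 + 2 * i.1 ∧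
      y.2.length = 2 ^ (y.1 + 1 - 2 * i.1) + 1}
  have hS : ∀ b ∈ Hmax, (S b).Finite ∧ (S b).ncard * 2 ^ k ≤ 2 ^ i.2 := by
    intro b hb
    by_cases hne : S b = ∅
    · simp [hne]
    obtain ⟨z, ⟨n, Z⟩, hy, hz, h1, h2, h3⟩ := Set.nonempty_iff_ne_empty.2 hne
    simp only at hz h1 h2 h3
    have hsub : S b ⊆ (Z.toFinset : Set (List Bool)) := by
      rintro z' ⟨⟨n', Z'⟩, hy', hz', h1', h2', h3'⟩
      have e : n' = n := by simp only at h2'; omega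
      have e' := List.inj_on_of_nodup_map (hnd b hb) hy' hy e
      simpa [(Prod.mk.inj e').2] using hz'
    refine ⟨(Finset.finite_toSet _).subset hsub, ?_⟩
    have h4 := Set.ncard_le_ncard hsub (Finset.finite_toSet _)
    rw [Set.ncard_coe_finset] at h4
    have h5 := h4.trans (List.toFinset_card_le Z)
    refine (Nat.mul_le_mul_right _ h5).trans ?_
    rw [h3, show i.2 = (n + 1 - 2 * i.1) + 1 + k by omega, pow_add _ _ k]
    refine Nat.mul_le_mul_right _ ?_
    rw [pow_succ]
    have := Nat.one_le_two_pow (n := n + 1 - 2 * i.1)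
    omega
  have hsub : {z | Assigned Hist k i z} ⊆ ⋃ b ∈ Hmax.toFinset, S b := by
    rintro z ⟨⟨⟨b, l⟩, y⟩, hh, hy, hz, h⟩
    exact Set.mem_biUnion (x := b)
      (by simpa using (hsuf _ hh).subset List.mem_cons_self) ⟨y, hy, hz, h⟩
  have hfin : (⋃ b ∈ Hmax.toFinset, S b).Finite :=
    (Finset.finite_toSet _).biUnion fun b hb => (hS b (by simpa using hb)).1
  refine ⟨hfin.subset hsub, ?_⟩
  have h1 := (Set.ncard_le_ncard hsub hfin).trans (Finset.set_ncard_biUnion_le _ _)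
  have h2 : (∑ b ∈ Hmax.toFinset, (S b).ncard) * 2 ^ k ≤ 2 ^ i.2 * 2 ^ k := by
    rw [Finset.sum_mul]
    refine (Finset.sum_le_card_nsmul _ _ (2 ^ i.2)
      fun b hb => (hS b (by simpa using hb)).2).trans ?_
    rw [smul_eq_mul, mul_comm]
    exact Nat.mul_le_mul_left _ ((List.toFinset_card_le _).trans hlen)
  exact h1.trans (Nat.le_of_mul_le_mul_right h2 (by positivity))

/-- Error-free algorithms do not support a claim that concerns strings of small complexity. -/
theorem SupportsClaim.not_errorFree {U : List Bool →. List Bool}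
    {Γ : RandomizedAlgorithm (List Bool) Bool} {j : ℕ} {b : List (ℕ × List (List Bool))}
    {X : ℕ → Bool} {N : ℕ} (h : SupportsClaim U Γ.next j b (bitPrefix X N))
    (hb : ∀ n Z, (n, Z) ∈ b → 2 * j ≤ n → Z.length = 2 ^ (n + 1 - 2 * j) + 1 →
      ∀ z ∈ Z, complexity U z ≤ n) :
    ¬ ErrorFree (Γ.run X) U.Dom := by
  classical
  intro herr
  obtain ⟨-, ⟨⟨n, Z⟩, D⟩, hy, ⟨h1, h2, h3⟩, ⟨h4, h5⟩, h6⟩ := h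
  have hp : ∀ z, z ∈ Z → ∃ p, z ∈ U p ∧ p.length ≤ n := fun z hz =>
    exists_program (hb n Z hy h1 h3 z hz)
  choose! p hpU hpn using hp
  have hinj : Set.InjOn p (Z.toFinset : Set (List Bool)) := by
    intro z hz w hw e
    have h1 := hpU z (by simpa using hz)
    rw [e] at h1
    exact Part.mem_unique h1 (hpU w (by simpa using hw))
  -- A string in `D` is outside the domain or has its value outside `Z`. So the programs for `Z` lie
  -- outside `D`, where at most `2 ^ (n + 1 - 2 * j)` strings of length at most `n` remain: one too
  -- few.
  have hdisj : Disjoint (Z.toFinset.image p) D.toFinset := by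
    refine Finset.disjoint_left.2 fun q hq hqD => ?_
    obtain ⟨z, hz, rfl⟩ := Finset.mem_image.1 hq
    rw [List.mem_toFinset] at hz hqD
    rcases (h6 _ hqD).2 with hf | ⟨-, w, hw, hwZ⟩
    · exact (herr (p z)).2 (mem_run_iff_outputsOn.2 ⟨N, hf⟩) (Part.dom_iff_mem.2 ⟨z, hpU z hz⟩)
    · exact hwZ (Part.mem_unique hw (hpU z hz) ▸ hz)
  have hsub : Z.toFinset.image p ∪ D.toFinset ⊆ (finite_length_le n).toFinset := by
    intro q hq
    rw [Set.Finite.mem_toFinset]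
    rcases Finset.mem_union.1 hq with hq | hq
    · obtain ⟨z, hz, rfl⟩ := Finset.mem_image.1 hq
      exact hpn z (by simpa using hz)
    · exact (h6 q (by simpa using hq)).1
  have hcard := Finset.card_le_card hsub
  rw [Finset.card_union_of_disjoint hdisj, Finset.card_image_of_injOn hinj,
    List.toFinset_card_of_nodup h2, List.toFinset_card_of_nodup h4,
    ← Set.ncard_eq_toFinset_card _ (finite_length_le n), ncard_length_le, h3] at hcard
  have := Nat.one_le_two_pow (n := n + 1)
  simp only at h5 hcard h3
  omega

/-- The algorithm answers, having read `N` bits, all but about `2 ^ (n + 1 - 2 * j)` of the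
strings of length at most `n`, for some `n ≤ N`. -/
def DenseBy (Γ : RandomizedAlgorithm (List Bool) Bool) (j N : ℕ) (X : ℕ → Bool) : Prop :=
  ∃ (n : ℕ) (D : List (List Bool)), n ≤ N ∧ 2 * j ≤ n ∧ D.Nodup ∧
    2 ^ (n + 1) ≤ D.length + 2 ^ (n + 1 - 2 * j) + 1 ∧
    ∀ x ∈ D, x.length ≤ n ∧ ∃ b, OutputsOn Γ.next (bitPrefix X N) x b

/-- Upper density one makes the fraction exceed `1 - 2 ^ (-2j)` for some `n ≥ 2j`, and the finitely
many answers involved use finitely many oracle bits. -/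
theorem exists_denseBy {Γ : RandomizedAlgorithm (List Bool) Bool} {X : ℕ → Bool}
    (h : upperDensity (Γ.run X).Dom = 1) (j : ℕ) : ∃ N, DenseBy Γ j N X := by
  classical
  have hlt : 1 - (2 : ℝ)⁻¹ ^ (2 * j) < limsup (fraction (Γ.run X).Dom) atTop := by
    rw [show limsup (fraction (Γ.run X).Dom) atTop = 1 from h]
    have : (0 : ℝ) < 2⁻¹ ^ (2 * j) := by positivity
    linarith
  have hfreq := frequently_lt_of_lt_limsup
    (isCoboundedUnder_le_of_le atTop fun n => fraction_nonneg (Γ.run X).Dom n) hlt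
  obtain ⟨n, hn, hjn⟩ := (hfreq.and_eventually (eventually_ge_atTop (2 * j))).exists
  have hfin := finite_length_le_and (Γ.run X).Dom n
  set D := hfin.toFinset.toList with hD
  have hmemD : ∀ x, x ∈ D ↔ x.length ≤ n ∧ x ∈ (Γ.run X).Dom := fun x => by simp [hD]
  have hout : ∀ x ∈ D, ∃ N, ∃ b, OutputsOn Γ.next (bitPrefix X N) x b := fun x hx => by
    obtain ⟨b, hb⟩ := Part.dom_iff_mem.1 ((hmemD x).1 hx).2
    obtain ⟨N, hN⟩ := mem_run_iff_outputsOn.1 hb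
    exact ⟨N, b, hN⟩
  choose! N hN using hout
  refine ⟨max n (D.map N).sum, n, D, le_max_left _ _, hjn, Finset.nodup_toList _, ?_,
    fun x hx => ⟨((hmemD x).1 hx).1, ?_⟩⟩
  · have hlen : D.length = {x : List Bool | x.length ≤ n ∧ x ∈ (Γ.run X).Dom}.ncard := by
      rw [hD, Finset.length_toList, ← Set.ncard_eq_toFinset_card _ hfin]
    rw [fraction, lt_div_iff₀ (fraction_denominator_pos n), ← hlen] at hn
    have h1 : (2 : ℝ)⁻¹ ^ (2 * j) * 2 ^ (n + 1) = 2 ^ (n + 1 - 2 * j) := by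
      rw [inv_pow, pow_sub₀ _ (by norm_num) (by omega)]
      ring
    have h2 : (0 : ℝ) < 2⁻¹ ^ (2 * j) := by positivity
    have h3 : (2 : ℝ) ^ (n + 1) ≤ D.length + 2 ^ (n + 1 - 2 * j) + 1 := by
      rw [← h1]
      nlinarith
    exact_mod_cast h3
  · obtain ⟨b, hb⟩ := hN x hx
    exact ⟨b, hb.mono ((List.single_le_sum (by simp) _ (List.mem_map_of_mem hx)).trans
      (le_max_right _ _))⟩

/-- There are claims that are supported by all oracles of error-free and dense computations. -/
theorem exists_supportsClaim (U : List Bool →. List Bool)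
    (Γ : RandomizedAlgorithm (List Bool) Bool) (j N : ℕ) :
    ∃ b : List (ℕ × List (List Bool)), ∀ X, ErrorFree (Γ.run X) U.Dom → DenseBy Γ j N X →
      SupportsClaim U Γ.next j b (bitPrefix X N) := by
  classical
  -- Programs of length at most `N` have finitely many values, so every `Z n` can avoid them all;
  -- then each correct answer `true` comes with a value outside `Z n`.
  have hout : {z | ∃ x, x.length ≤ N ∧ z ∈ U x}.Finite := by
    refine ((finite_length_le N).image fun x =>
      if h : (U x).Dom then (U x).get h else []).subset ?_
    rintro z ⟨x, hx, hz⟩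
    exact ⟨x, hx, by simp [Part.dom_iff_mem.2 ⟨z, hz⟩, Part.get_eq_of_mem hz]⟩
  have hZ : ∀ n : ℕ, ∃ Z : List (List Bool), Z.Nodup ∧ Z.length = 2 ^ (n + 1 - 2 * j) + 1 ∧
      ∀ z ∈ Z, z ∉ {z | ∃ x, x.length ≤ N ∧ z ∈ U x} := fun n => by
    obtain ⟨F, hF, hcard⟩ := hout.infinite_compl.exists_subset_card_eq (2 ^ (n + 1 - 2 * j) + 1)
    exact ⟨F.toList, F.nodup_toList, by simpa using hcard, fun z hz => hF (by simpa using hz)⟩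
  choose Z hZ1 hZ2 hZ3 using hZ
  refine ⟨(List.range (N + 1)).map fun n => (n, Z n), fun X herr h => ⟨?_, ?_⟩⟩
  · simpa [List.map_map, Function.comp_def] using List.nodup_range
  · obtain ⟨n, D, hnN, hjn, hnd, hcard, hD⟩ := h
    refine ⟨((n, Z n), D), List.mem_map.2 ⟨n, by simpa using by omega, rfl⟩,
      ⟨hjn, hZ1 n, hZ2 n⟩, ⟨hnd, hcard⟩, fun x hx => ⟨(hD x hx).1, ?_⟩⟩
    obtain ⟨hlen, b, hb⟩ := hD x hx
    cases b
    · exact Or.inl hb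
    · obtain ⟨z, hz⟩ := Part.dom_iff_mem.1 ((herr x).1 (mem_run_iff_outputsOn.2 ⟨N, hb⟩))
      exact Or.inr ⟨hb, z, hz, fun hzZ => hZ3 n z hzZ ⟨x, hlen.trans hnN, hz⟩⟩

/-- The games for all `j` are enumerated together, so the constant `c` of the complexity bound does
not depend on `j`, and `j` can be chosen after `c`. -/
theorem measure_errorFree_upperDensity_one {U : List Bool →. List Bool} (hU : IsOptimal U)
    (Γ : RandomizedAlgorithm (List Bool) Bool) :
    coinMeasure {X | ErrorFree (Γ.run X) U.Dom ∧ upperDensity (Γ.run X).Dom = 1} = 0 := by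
  set G := {X | ErrorFree (Γ.run X) U.Dom ∧ upperDensity (Γ.run X).Dom = 1}
  have key : ∀ k : ℕ, coinMeasure G ≤ (2⁻¹ : ENNReal) ^ k := by
    intro k
    obtain ⟨Hist, hre, hHist⟩ := exists_diagonalization
      (R := fun j _ b σ => SupportsClaim U Γ.next j b σ)
      (SupportsClaim.re hU.1 Γ.partrec_next) (Primrec.const k)
    have hcount : ∀ i : ℕ × ℕ, {z | Assigned Hist k i z}.Finite ∧
        {z | Assigned Hist k i z}.ncard ≤ 2 ^ i.2 := fun i => by
      obtain ⟨Hmax, K, -, hlen, hsuf, hlegal, -, -⟩ := hHist i.1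
      refine Assigned.ncard_le hlen hsuf fun b hb => ?_
      obtain ⟨r, l, rfl⟩ := List.append_of_mem hb
      obtain ⟨σ, hσ⟩ := (hlegal l b (List.suffix_append _ _)).2
      exact hσ.1
    obtain ⟨c, hc⟩ := hU.complexity_le_of_enumerable (Assigned.re hre k)
      (fun i => (hcount i).1) fun i => (hcount i).2
    -- With `m = n + 2 + k - 2j`, the complexity bound `m + j + c` equals `n + 2 + k + c - j`, which
    -- is exactly `n` for this `j`.
    set j := 2 + k + c with hj
    obtain ⟨Hmax, K, -, -, -, hlegal, hK, hlast⟩ := hHist j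
    have hdisj : Disjoint G K := by
      refine Set.disjoint_left.2 fun X hX hXK => ?_
      obtain ⟨l, b, N, hbl, hclaim⟩ := hK X hXK
      refine hclaim.not_errorFree (fun n Z hZ hjn hlen z hz => ?_) hX.1
      refine (hc j (n + 2 + k - 2 * j) z ⟨((b, l), (n, Z)), (hlegal l b hbl).1, hZ, hz, hjn,
        ?_, hlen⟩).trans ?_
      · simp only
        omega
      · exact_mod_cast (by omega : n + 2 + k - 2 * j + j + c ≤ n)
    -- The final position limits the support of one action at a time. A common bound `N` on lengths
    -- and oracle bits lets one action serve all oracles considered.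
    refine measure_le_of_subset_iUnion_monotone (s := fun N => {X ∈ G | DenseBy Γ j N X})
      (fun M N hMN X hX => ⟨hX.1, ?_⟩) (fun X hX => ?_) fun N => ?_
    · obtain ⟨n, D, h1, h2, h3, h4, h5⟩ := hX.2
      exact ⟨n, D, h1.trans hMN, h2, h3, h4, fun x hx =>
        ⟨(h5 x hx).1, (h5 x hx).2.imp fun b hb => hb.mono hMN⟩⟩
    · exact Set.mem_iUnion.2 ((exists_denseBy hX.2 j).imp fun N hN => ⟨hX, hN⟩)
    · obtain ⟨b, hb⟩ := exists_supportsClaim U Γ j N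
      rw [← ENNReal.inv_pow]
      exact hlast b _ (hdisj.mono_left fun X hX => hX.1) fun X hX => ⟨N, hb X hX.1.1 hX.2⟩
  have hlim : Tendsto (fun t : ℕ => (2⁻¹ : ENNReal) ^ t) atTop (𝓝 0) :=
    ENNReal.tendsto_pow_atTop_nhds_zero_of_lt_one (by simp)
  exact le_antisymm (ge_of_tendsto' hlim key) zero_le

/-! ### Universal machines -/

/-- The machine that applies the function with code `j` to `w` on input `withHeader j w`. -/
def universalMachine : List Bool →. List Bool := fun p =>
  codeFunction (Denumerable.ofNat Nat.Partrec.Code (splitHeader p).1) (splitHeader p).2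

theorem partrec_universalMachine : Partrec universalMachine :=
  partrec_codeFunction.comp
    ((Primrec.ofNat _).comp (Primrec.fst.comp primrec_splitHeader)).to_comp
    (Primrec.snd.comp primrec_splitHeader).to_comp

theorem universalMachine_withHeader (c : Nat.Partrec.Code) (x : List Bool) :
    universalMachine (withHeader (Encodable.encode c) x) = codeFunction c x := by
  simp [universalMachine, splitHeader_withHeader]

theorem isEffectivelyOptimal_universalMachine : IsEffectivelyOptimal universalMachine := by
  refine ⟨partrec_universalMachine, fun V hV => ?_⟩
  obtain ⟨c, rfl⟩ := exists_codeFunction_eq hV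
  refine ⟨withHeader (Encodable.encode c),
    (primrec_withHeader.comp (Primrec.const _) Primrec.id).to_comp,
    ⟨Encodable.encode c + 1, fun x => (length_withHeader _ x).le⟩, fun x => ?_⟩
  rw [universalMachine_withHeader]

theorem complexity_le_of_reduction {U V : List Bool →. List Bool} {c : ℕ}
    (h : ∀ p x, x ∈ V p → ∃ q, x ∈ U q ∧ q.length ≤ p.length + c) (x : List Bool) :
    complexity U x ≤ complexity V x + c := by
  rw [complexity.eq_def V, ENat.iInf_add]
  refine le_iInf fun p => ?_
  rw [ENat.iInf_add]
  refine le_iInf fun hp => ?_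
  obtain ⟨q, hq, hlen⟩ := h p x hp
  exact (complexity_le hq).trans (by exact_mod_cast hlen)

theorem IsEffectivelyOptimal.isOptimal {U : List Bool →. List Bool}
    (hU : IsEffectivelyOptimal U) : IsOptimal U := by
  refine ⟨hU.1, fun V hV => ?_⟩
  obtain ⟨h, -, ⟨c, hc⟩, hh⟩ := hU.2 V hV
  exact ⟨c, complexity_le_of_reduction fun p x hx => ⟨h p, hh p ▸ hx, hc p⟩⟩

theorem IsOptimal.of_reduction {U V : List Bool →. List Bool} (hV : IsOptimal V)
    (hU : Partrec U) {c : ℕ}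
    (h : ∀ p x, x ∈ V p → ∃ q, x ∈ U q ∧ q.length ≤ p.length + c) : IsOptimal U := by
  refine ⟨hU, fun W hW => ?_⟩
  obtain ⟨d, hd⟩ := hV.2 W hW
  refine ⟨d + c, fun x => (complexity_le_of_reduction h x).trans ?_⟩
  push_cast
  rw [← add_assoc]
  exact add_le_add_left (hd x) _

theorem isOptimal_universalMachine : IsOptimal universalMachine :=
  isEffectivelyOptimal_universalMachine.isOptimal

/-! ### Left-total machines -/

/-- In each length separately, the `t`-th program on which the universal machine is found to halt is
moved to the string of that length with value `t`. Programs keep their lengths, so optimality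
survives, and the new domain is an initial segment. -/
theorem exists_leftTotal_optimal : ∃ U : List Bool →. List Bool, IsOptimal U ∧ LeftTotal U := by
  have hfin : ∀ n, {p : List Bool | p.length = n ∧ (universalMachine p).Dom}.Finite := fun n =>
    (List.finite_length_eq Bool n).subset fun p hp => hp.1
  have hre : REPred fun x : ℕ × List Bool => x.2.length = x.1 ∧ (universalMachine x.2).Dom :=
    REPred.and (Primrec.eq.comp (Primrec.list_length.comp Primrec.snd) Primrec.fst).to_re
      (partrec_universalMachine.comp Computable.snd).dom_re
  obtain ⟨e, he, hsurj, hsound, hinit⟩ := REPred.exists_enumeration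
    (E := fun n p => p.length = n ∧ (universalMachine p).Dom) hre hfin
  have hdom : ∀ q : List Bool, ((e q.length (bitValue q)).bind universalMachine).Dom ↔
      (e q.length (bitValue q)).Dom := fun q =>
    ⟨fun h => h.fst, fun h => ⟨h, (hsound _ _ _ (Part.get_mem h)).2⟩⟩
  refine ⟨fun q => (e q.length (bitValue q)).bind universalMachine, ?_, fun p q hpq hlt hq => ?_⟩
  · refine isOptimal_universalMachine.of_reduction (c := 0) ?_ fun p x hx => ?_
    · exact Partrec.bind (he.comp Primrec.list_length.to_comp primrec_bitValue.to_comp)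
        (partrec_universalMachine.comp Computable.snd)
    · obtain ⟨t, ht, hpt⟩ := hsurj p.length p ⟨rfl, Part.dom_iff_mem.2 ⟨x, hx⟩⟩
      have hle : {q : List Bool | q.length = p.length ∧ (universalMachine q).Dom}.ncard ≤
          2 ^ p.length := by
        rw [← ncard_length_eq]
        exact Set.ncard_le_ncard (fun q hq => hq.1) (List.finite_length_eq Bool _)
      obtain ⟨w, hw, rfl⟩ := exists_bitValue_eq p.length t (ht.trans_le hle)
      exact ⟨w, Part.mem_bind_iff.2 ⟨p, hw ▸ hpt, hx⟩, hw.le⟩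
  · refine (hdom p).2 (hinit _ _ _ ((lt_iff_bitValue_lt hpq).1 hlt).le ?_)
    rw [hpq]
    exact (hdom q).1 hq

/-- A partial computable function as a randomized algorithm that uses no random bits. -/
def RandomizedAlgorithm.ofPartrec {α β : Type} [Primcodable α] [Primcodable β] (f : α →. β)
    (hf : Partrec f) : RandomizedAlgorithm α β where
  next x := (f x.1).map some
  partrec_next := (hf.comp Computable.fst).map (Computable.option_some.comp Computable.snd).to₂

theorem RandomizedAlgorithm.run_ofPartrec {α β : Type} [Primcodable α] [Primcodable β]
    (f : α →. β) (hf : Partrec f) (X : ℕ → Bool) : (ofPartrec f hf).run X = f := by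
  ext a b
  rw [RandomizedAlgorithm.mem_run]
  simp only [ofPartrec, Part.mem_map_iff, Option.some.injEq, exists_eq_right, reduceCtorEq,
    and_false, exists_false]
  exact ⟨fun ⟨k, hk, _⟩ => hk, fun h => ⟨0, h, fun j hj => absurd hj (Nat.not_lt_zero j)⟩⟩

/-- The largest limit point of a bounded sequence of natural numbers. -/
theorem exists_frequently_eq_eventually_le {u : ℕ → ℕ} {M : ℕ} (hM : ∀ᶠ n in atTop, u n ≤ M) :
    ∃ T, (∃ᶠ n in atTop, u n = T) ∧ ∀ᶠ n in atTop, u n ≤ T := by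
  classical
  have hex : ∃ T, ∀ᶠ n in atTop, u n ≤ T := ⟨M, hM⟩
  refine ⟨Nat.find hex, ?_, Nat.find_spec hex⟩
  intro hne
  have h1 := (Nat.find_spec hex).and hne
  rcases Nat.eq_zero_or_pos (Nat.find hex) with h0 | h0
  · obtain ⟨n, hn, hn'⟩ := h1.exists
    exact hn' (by omega)
  · refine Nat.find_min hex (m := Nat.find hex - 1) (by omega) ?_
    filter_upwards [h1] with n hn
    have := hn.1
    have : u n ≠ Nat.find hex := hn.2
    omega

/-- Under the assumption that at most `c` strings of length at most `n` are in `dom U`, the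
string `x` cannot be one of them. -/
def Refuted (U : List Bool →. List Bool) (n c : ℕ) (x : List Bool) (L : List (List Bool)) :
    Prop :=
  x.length ≤ n ∧ L.Nodup ∧ c < L.length ∧
    ∀ y ∈ L, y.length ≤ n ∧ ((U y).Dom ∨ (y.length = x.length ∧ bitValue y ≤ bitValue x))

/-- If `x` is in the domain, left-totality puts the strings of its length with smaller values there
too, hence all of `L`. -/
theorem LeftTotal.lt_ncard_of_refuted {U : List Bool →. List Bool} (hU : LeftTotal U) {n c : ℕ}
    {x : List Bool} {L : List (List Bool)} (h : Refuted U n c x L) (hx : (U x).Dom) :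
    c < {y : List Bool | y.length ≤ n ∧ y ∈ U.Dom}.ncard := by
  classical
  obtain ⟨-, hnd, hc, hL⟩ := h
  refine hc.trans_le ?_
  rw [← List.toFinset_card_of_nodup hnd, ← Set.ncard_coe_finset]
  refine Set.ncard_le_ncard (fun y hy => ?_) (finite_length_le_and _ n)
  obtain ⟨h1, h2⟩ := hL y (by simpa using hy)
  refine ⟨h1, ?_⟩
  rcases h2 with h2 | ⟨h2, h3⟩
  · exact h2
  · rcases h3.lt_or_eq with h3 | h3
    · exact hU y x h2 ((lt_iff_bitValue_lt h2).2 h3) hx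
    · exact bitValue_injective h2 h3 ▸ hx

theorem Refuted.re {U : List Bool →. List Bool} (hU : Partrec U) {c : ℕ → ℕ} (hc : Primrec c)
    (n₀ : ℕ) : REPred fun x => ∃ y : ℕ × List (List Bool), n₀ ≤ y.1 ∧
      Refuted U y.1 (c y.1) x y.2 := by
  refine REPred.exists (p := fun (x : List Bool) (y : ℕ × List (List Bool)) => n₀ ≤ y.1 ∧
      Refuted U y.1 (c y.1) x y.2) ?_
  have hn : Primrec fun x : List Bool × (ℕ × List (List Bool)) => x.2.1 :=
    Primrec.fst.comp Primrec.snd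
  have hL : Primrec fun x : List Bool × (ℕ × List (List Bool)) => x.2.2 :=
    Primrec.snd.comp Primrec.snd
  have hin : REPred fun x : (List Bool × (ℕ × List (List Bool))) × List Bool =>
      x.2.length ≤ x.1.2.1 ∧ ((U x.2).Dom ∨
        (x.2.length = x.1.1.length ∧ bitValue x.2 ≤ bitValue x.1.1)) := by
    refine REPred.and (PrimrecPred.to_re ?_) (REPred.or (hU.comp Computable.snd).dom_re
      (PrimrecPred.to_re (PrimrecPred.and ?_ ?_)))
    · exact Primrec.nat_le.comp (Primrec.list_length.comp Primrec.snd) (hn.comp Primrec.fst)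
    · exact Primrec.eq.comp (Primrec.list_length.comp Primrec.snd)
        (Primrec.list_length.comp (Primrec.fst.comp Primrec.fst))
    · exact Primrec.nat_le.comp (primrec_bitValue.comp Primrec.snd)
        (primrec_bitValue.comp (Primrec.fst.comp Primrec.fst))
  refine REPred.and (Primrec.nat_le.comp (Primrec.const n₀) hn).to_re (REPred.and
    (Primrec.nat_le.comp (Primrec.list_length.comp Primrec.fst) hn).to_re (REPred.and
      (PrimrecPred.list_nodup.comp hL).to_re (REPred.and
        (Primrec.nat_lt.comp (hc.comp hn) (Primrec.list_length.comp hL)).to_re ?_)))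
  exact REPred.forall_mem_list (f := fun x : List Bool × (ℕ × List (List Bool)) => x.2.2)
    (p := fun (x : List Bool × (ℕ × List (List Bool))) y => y.length ≤ x.2.1 ∧ ((U y).Dom ∨
      (y.length = x.1.length ∧ bitValue y ≤ bitValue x.1))) hin hL.to_comp

/-- If the number of strings of length at most `n` in `dom U` plus `q` exceeds `c`, then all but
at most `q` strings of each length are either in `dom U` or refuted. -/
theorem ncard_not_refuted_le {U : List Bool →. List Bool} {n c q : ℕ}
    (hq : c < {y : List Bool | y.length ≤ n ∧ y ∈ U.Dom}.ncard + (q + 1)) {m : ℕ} (hm : m ≤ n) :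
    {x : List Bool | x.length = m ∧ ¬ ((U x).Dom ∨ ∃ L, Refuted U n c x L)}.ncard ≤ q := by
  classical
  set M := {x : List Bool | x.length = m ∧ ¬ ((U x).Dom ∨ ∃ L, Refuted U n c x L)}
  have hM : M.Finite := (List.finite_length_eq Bool m).subset fun x hx => hx.1
  have hD := finite_length_le_and U.Dom n
  by_contra hlt
  rw [not_le] at hlt
  have hne : M.Nonempty := (Set.ncard_pos hM).1 (by omega)
  -- For the rightmost undecided string, all undecided strings of length `m` have values at most its
  -- own. Together with the domain they exceed `c` and refute it.
  obtain ⟨x, hx, hmax⟩ := hM.toFinset.exists_max_image bitValue (by simpa using hne)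
  have hxM : x ∈ M := by simpa using hx
  refine hxM.2 (Or.inr ⟨(hM.toFinset ∪ hD.toFinset).toList, hxM.1.trans_le hm,
    Finset.nodup_toList _, ?_, fun y hy => ?_⟩)
  · rw [Finset.length_toList, Finset.card_union_of_disjoint, ← Set.ncard_eq_toFinset_card _ hM,
      ← Set.ncard_eq_toFinset_card _ hD]
    · omega
    · refine Finset.disjoint_left.2 fun y hy hy' => ?_
      rw [Set.Finite.mem_toFinset] at hy hy'
      exact hy.2 (Or.inl hy'.2)
  · rw [Finset.mem_toList, Finset.mem_union, Set.Finite.mem_toFinset, Set.Finite.mem_toFinset] at hy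
    rcases hy with hy | hy
    · exact ⟨hy.1.trans_le hm, Or.inr ⟨hy.1.trans hxM.1.symm, hmax y (by simpa using hy)⟩⟩
    · exact ⟨hy.1, Or.inl hy.2⟩

/-- The algorithm is deterministic: it waits until `x` halts or is refuted, with `k`, `T` and `n₀`
built in. The bound behind the refutations holds for all `n ≥ n₀`, so there are no errors, and it is
nearly sharp infinitely often. -/
theorem LeftTotal.ioGenericallyProbComputable {U : List Bool →. List Bool} (hU : Partrec U)
    (hlt : LeftTotal U) {ε : ℝ} (hε : 0 < ε) : IOGenericallyProbComputable (1 - ε) U.Dom := by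
  classical
  obtain ⟨k, hk⟩ : ∃ k : ℕ, ((k : ℝ) + 1) * 2 / 2 ^ k ≤ ε := by
    have h1 : Tendsto (fun k : ℕ => (k : ℝ) ^ 1 * (1 / 2) ^ k) atTop (𝓝 0) :=
      tendsto_pow_const_mul_const_pow_of_abs_lt_one 1 (by rw [abs_of_pos] <;> norm_num)
    have h2 : Tendsto (fun k : ℕ => ((1 : ℝ) / 2) ^ k) atTop (𝓝 0) :=
      tendsto_pow_atTop_nhds_zero_of_lt_one (by norm_num) (by norm_num)
    have h3 := (h1.add h2).const_mul 2
    simp only [add_zero, mul_zero] at h3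
    obtain ⟨k, hk⟩ := (h3.eventually (ge_mem_nhds hε)).exists
    refine ⟨k, le_of_eq_of_le ?_ hk⟩
    rw [one_div, inv_pow, pow_one]
    ring
  let cnt : ℕ → ℕ := fun n => {y : List Bool | y.length ≤ n ∧ y ∈ U.Dom}.ncard
  have hcnt : ∀ n, cnt n < 2 ^ (n + 1) := fun n => by
    have h1 := Set.ncard_le_ncard (s := {y : List Bool | y.length ≤ n ∧ y ∈ U.Dom})
      (t := {y : List Bool | y.length ≤ n}) (fun y hy => hy.1) (finite_length_le n)
    rw [ncard_length_le] at h1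
    have := Nat.one_le_two_pow (n := n + 1)
    simp only [cnt]
    omega
  obtain ⟨T, hfreq, hev⟩ := exists_frequently_eq_eventually_le (M := 2 ^ k)
    (u := fun n => cnt n / 2 ^ (n + 1 - k)) (by
      filter_upwards [eventually_ge_atTop k] with n hn
      refine (Nat.div_le_div_right (hcnt n).le).trans (le_of_eq ?_)
      refine Nat.div_eq_of_eq_mul_left (by positivity) ?_
      rw [← pow_add]
      congr 1
      omega)
  obtain ⟨n₀, hn₀⟩ := eventually_atTop.1 (hev.and (eventually_ge_atTop k))
  -- This is the largest count whose quotient by `2 ^ (n + 1 - k)` is at most `T`. When the quotient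
  -- equals `T`, it exceeds the true count by less than `2 ^ (n + 1 - k)`.
  let c : ℕ → ℕ := fun n => (T + 1) * 2 ^ (n + 1 - k) - 1
  have hc : Primrec c := Primrec.pred.comp (Primrec.nat_mul.comp (Primrec.const _)
    (Primrec.nat_pow.comp (Primrec.const 2)
      (Primrec.nat_sub.comp Primrec.succ (Primrec.const k))))
  have hcpos : ∀ n, c n + 1 = (T + 1) * 2 ^ (n + 1 - k) := fun n =>
    Nat.sub_add_cancel (Nat.mul_pos (by omega) (by positivity))
  have hle : ∀ n, n₀ ≤ n → cnt n ≤ c n := fun n hn => by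
    have h1 := (hn₀ n hn).1
    have h2 := (Nat.div_lt_iff_lt_mul (by positivity)).1 (Nat.lt_succ_of_le h1)
    have h3 := hcpos n
    rw [Nat.succ_eq_add_one] at h2
    omega
  obtain ⟨f, hf, hft, hff⟩ := REPred.exists_separator hU.dom_re (Refuted.re hU hc n₀)
    fun x hx ⟨y, hy, hr⟩ => absurd (hlt.lt_ncard_of_refuted hr hx) (not_lt.2 (hle y.1 hy))
  refine ⟨RandomizedAlgorithm.ofPartrec f hf, ?_⟩
  simp only [RandomizedAlgorithm.run_ofPartrec]
  have htriv : ErrorFree f U.Dom ∧ ∃ᶠ n in atTop, 1 - ε ≤ fraction f.Dom n := by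
    refine ⟨fun x => ⟨(hft x).1, fun h hx => ?_⟩, ?_⟩
    · obtain ⟨y, hy, hr⟩ := (hff x).1 h
      exact absurd (hlt.lt_ncard_of_refuted hr hx) (not_lt.2 (hle y.1 hy))
    refine (hfreq.and_eventually (eventually_ge_atTop n₀)).mono fun n ⟨hT, hn⟩ => ?_
    have hkn : k ≤ n := (hn₀ n hn).2
    set Q := 2 ^ (n + 1 - k) with hQ
    have hTQ : T * Q ≤ cnt n := hT ▸ Nat.div_mul_le_self _ _
    have hmiss : ∀ m ≤ n, {x : List Bool | x.length = m ∧ x ∉ f.Dom}.ncard ≤ Q := by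
      intro m hm
      have h1 : c n < cnt n + (Q + 1) := by
        have := hcpos n
        rw [add_mul, one_mul, ← hQ] at this
        omega
      refine le_trans (Set.ncard_le_ncard ?_ ?_) (ncard_not_refuted_le h1 hm)
      · rintro x ⟨hx, hxf⟩
        refine ⟨hx, fun h => hxf ?_⟩
        rcases h with h | ⟨L, hL⟩
        · exact Part.dom_iff_mem.2 ⟨true, (hft x).2 h⟩
        · exact Part.dom_iff_mem.2 ⟨false, (hff x).2 ⟨(n, L), hn, hL⟩⟩
      · exact (List.finite_length_eq Bool m).subset fun x hx => hx.1
    -- Each of the top `k` lengths misses at most `Q` strings, and all shorter lengths together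
    -- contain fewer than `Q = 2 ^ (n + 1 - k)` strings.
    have htotal : {x : List Bool | x.length ≤ n ∧ x ∉ f.Dom}.ncard ≤ (k + 1) * Q := by
      have h1 := ncard_length_le_and_eq_sum f.Domᶜ n
      simp only [Set.mem_compl_iff] at h1
      rw [h1, show n + 1 = (n + 1 - k) + k by omega, Finset.sum_range_add, add_mul, one_mul,
        add_comm]
      refine add_le_add ?_ ?_
      · refine (Finset.sum_le_card_nsmul _ _ Q fun i hi => hmiss _ ?_).trans (by simp)
        have := Finset.mem_range.1 hi
        omega
      · refine (Finset.sum_le_sum (g := fun m => 2 ^ m) fun m _ => ?_).trans ?_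
        · rw [← ncard_length_eq]
          exact Set.ncard_le_ncard (fun x hx => hx.1) (List.finite_length_eq Bool m)
        · rw [Nat.geomSum_eq le_rfl]
          simp [hQ]
    have h1 := ncard_add_ncard_compl f.Dom n
    have h2 := fraction_denominator_pos n
    rw [fraction, le_div_iff₀ h2]
    have h3 : ({x : List Bool | x.length ≤ n ∧ x ∉ f.Dom}.ncard : ℝ) ≤ (k + 1) * Q := by
      exact_mod_cast htotal
    have h4 : ((k : ℝ) + 1) * Q ≤ ε * 2 ^ n := by
      refine le_trans (le_of_eq ?_) (mul_le_mul_of_nonneg_right hk (by positivity))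
      rw [hQ]
      push_cast
      rw [pow_sub₀ _ (by norm_num) (by omega), pow_succ]
      ring
    have h5 := mul_le_mul_of_nonneg_left (two_pow_le_fraction_denominator n) hε.le
    linarith
  rw [show {X : ℕ → Bool | ErrorFree f U.Dom ∧ ∃ᶠ n in atTop, 1 - ε ≤ fraction f.Dom n} = Set.univ
    from Set.eq_univ_of_forall fun _ => htriv, measure_univ]
  exact one_pos

/-! ### Reductions of a sparse simple set -/

/-- On input `x` satisfying `w`, the algorithm `Γ` is applied to `h x`, and `x` is the output if
the answer is `false`. -/
def RandomizedAlgorithm.rejected (Γ : RandomizedAlgorithm (List Bool) Bool)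
    {h : List Bool → List Bool} (hh : Computable h) {w : List Bool → Bool} (hw : Computable w) :
    RandomizedAlgorithm ℕ (List Bool) where
  next y := ((Encodable.decode (α := List Bool) y.1 : Option (List Bool)) :
      Part (List Bool)).bind fun x =>
    bif w x then (Γ.next (h x, y.2)).bind fun o =>
      bif o.isSome then bif o.getD false then Part.none else Part.some (some x)
      else Part.some none
    else Part.none
  partrec_next := by
    refine Partrec.bind (Computable.ofOption (Computable.decode.comp Computable.fst)) ?_
    refine Partrec.cond (hw.comp Computable.snd) ?_ Partrec.none
    refine Partrec.bind (Γ.partrec_next.comp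
      ((hh.comp Computable.snd).pair (Computable.snd.comp Computable.fst))) ?_
    refine Partrec.cond (Primrec.option_isSome.to_comp.comp Computable.snd) ?_
      (Computable.const none).partrec
    refine Partrec.cond (Computable.option_getD Computable.snd (Computable.const false))
      Partrec.none ?_
    exact (Computable.option_some.comp (Computable.snd.comp Computable.fst)).partrec

theorem RandomizedAlgorithm.enumerated_rejected (Γ : RandomizedAlgorithm (List Bool) Bool)
    {h : List Bool → List Bool} (hh : Computable h) {w : List Bool → Bool} (hw : Computable w)
    (X : ℕ → Bool) :
    (Γ.rejected hh hw).enumerated X = {x | w x = true ∧ false ∈ Γ.run X (h x)} := by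
  have hsome : ∀ i σ x, some x ∈ (Γ.rejected hh hw).next (i, σ) ↔
      Encodable.decode i = some x ∧ w x = true ∧ some false ∈ Γ.next (h x, σ) := by
    intro i σ x
    simp only [rejected, Part.mem_bind_iff, Part.mem_ofOption, Option.mem_def]
    constructor
    · rintro ⟨y, hy, hx⟩
      by_cases hwy : w y = true
      · rw [hwy, cond_true, Part.mem_bind_iff] at hx
        obtain ⟨o, ho, hx⟩ := hx
        rcases o with - | (- | -)
        · simp at hx
        · obtain rfl : x = y := by simpa using hx
          exact ⟨hy, hwy, ho⟩
        · simp at hx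
      · simp [hwy] at hx
    · rintro ⟨hx, hwx, ho⟩
      refine ⟨x, hx, ?_⟩
      rw [hwx, cond_true, Part.mem_bind_iff]
      exact ⟨_, ho, by simp⟩
  have hnone : ∀ i σ x, Encodable.decode i = some x → w x = true →
      (none ∈ (Γ.rejected hh hw).next (i, σ) ↔ none ∈ Γ.next (h x, σ)) := by
    intro i σ x hx hwx
    simp only [rejected, hx, Part.coe_some, Part.bind_some, hwx, cond_true, Part.mem_bind_iff]
    constructor
    · rintro ⟨o, ho, hn⟩
      rcases o with - | (- | -)
      · exact ho
      · simp at hn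
      · simp at hn
    · exact fun ho => ⟨_, ho, by simp⟩
  ext x
  simp only [enumerated, Set.mem_ofPred_eq, mem_run]
  constructor
  · rintro ⟨i, k, hk, hj⟩
    obtain ⟨h1, h2, h3⟩ := (hsome _ _ _).1 hk
    exact ⟨h2, k, h3, fun j hjk => (hnone _ _ _ h1 h2).1 (hj j hjk)⟩
  · rintro ⟨h2, k, h3, hj⟩
    have h1 := Encodable.encodek x
    exact ⟨Encodable.encode x, k, (hsome _ _ _).2 ⟨h1, h2, h3⟩,
      fun j hjk => (hnone _ _ _ h1 h2).2 (hj j hjk)⟩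

/-- If `h` reduces `S` to `A` on a decidable set of inputs, and almost surely no infinite subset
of the complement of `S` is enumerated, then almost surely an error-free algorithm for `A` answers
only finitely many of the questions `h x` with `x ∉ S`. -/
theorem measure_errorFree_infinite {S A : Set (List Bool)}
    (hS : ∀ Γ : RandomizedAlgorithm ℕ (List Bool),
      coinMeasure {X | (Γ.enumerated X).Infinite ∧ Γ.enumerated X ⊆ Sᶜ} = 0)
    {h : List Bool → List Bool} (hh : Computable h) {w : List Bool → Bool} (hw : Computable w)
    (hA : ∀ x, w x = true → (h x ∈ A ↔ x ∈ S)) (Γ : RandomizedAlgorithm (List Bool) Bool) :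
    coinMeasure {X | ErrorFree (Γ.run X) A ∧
      {x | w x = true ∧ x ∉ S ∧ h x ∈ (Γ.run X).Dom}.Infinite} = 0 := by
  refine measure_mono_null ?_ (hS (Γ.rejected hh hw))
  rintro X ⟨herr, hinf⟩
  simp only [Set.mem_ofPred_eq, RandomizedAlgorithm.enumerated_rejected]
  refine ⟨hinf.mono ?_, ?_⟩
  · rintro x ⟨hwx, hxS, hx⟩
    obtain ⟨b, hb⟩ := Part.dom_iff_mem.1 hx
    cases b
    · exact ⟨hwx, hb⟩
    · exact absurd ((hA x hwx).1 ((herr _).1 hb)) hxS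
  · rintro x ⟨hwx, hx⟩ hxS
    exact (herr _).2 hx ((hA x hwx).2 hxS)

/-- A negative criterion: almost surely the domain of an error-free algorithm has density bounded
away from `r`. -/
theorem not_ioGenericallyProbComputable {S A : Set (List Bool)} {r : ℝ}
    (hS : ∀ Γ : RandomizedAlgorithm ℕ (List Bool),
      coinMeasure {X | (Γ.enumerated X).Infinite ∧ Γ.enumerated X ⊆ Sᶜ} = 0)
    {h : List Bool → List Bool} (hh : Computable h) {w : List Bool → Bool} (hw : Computable w)
    (hA : ∀ x, w x = true → (h x ∈ A ↔ x ∈ S))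
    (hr : ∀ D : Set (List Bool), {x | w x = true ∧ x ∉ S ∧ h x ∈ D}.Finite →
      ∀ᶠ n in atTop, fraction D n < r) :
    ¬ IOGenericallyProbComputable r A := by
  rintro ⟨Γ, hΓ⟩
  refine hΓ.ne' (measure_mono_null ?_ (measure_errorFree_infinite hS hh hw hA Γ))
  rintro X ⟨herr, hfreq⟩
  refine ⟨herr, fun hfin => ?_⟩
  obtain ⟨n, hn, hn'⟩ := (hfreq.and_eventually (hr _ hfin)).exists
  exact absurd hn (not_le.2 hn')

/-- Partial identity function with a given enumerable domain. -/
theorem REPred.exists_partial_snd {α β : Type} [Primcodable α] [Primcodable β]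
    {p : α → β → Prop} (hp : REPred fun x : α × β => p x.1 x.2) :
    ∃ f : α → β →. β, Partrec₂ f ∧ ∀ a b, (p a b → f a b = Part.some b) ∧
      (¬ p a b → f a b = Part.none) := by
  refine ⟨fun a b => (Part.assert (p a b) fun _ => Part.some ()).map fun _ => b,
    Partrec.map hp (Computable.snd.comp Computable.fst).to₂, fun a b => ⟨fun h => ?_, fun h => ?_⟩⟩
  · simp only [Part.assert_pos h, Part.map_some]
  · simp only [Part.assert_neg h, Part.map_none]

/-- An enumerable set is reducible to the domain of an effectively optimal machine by an
injective computable function that increases the length at most by a constant. -/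
theorem IsEffectivelyOptimal.exists_injective_reduction {U : List Bool →. List Bool}
    (hU : IsEffectivelyOptimal U) {S : Set (List Bool)} (hS : REPred fun x => x ∈ S) :
    ∃ h : List Bool → List Bool, Computable h ∧ LengthBounded h ∧ Function.Injective h ∧
      ∀ x, h x ∈ U.Dom ↔ x ∈ S := by
  obtain ⟨h₀, hh₀, ⟨c₀, hc₀⟩, hred⟩ := hU.2 _ partrec_universalMachine
  let h : Nat.Partrec.Code → List Bool → List Bool := fun c x =>
    h₀ (withHeader (Encodable.encode c) x)
  have hh : Computable₂ h := hh₀.comp (primrec_withHeader.to_comp.comp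
    (Computable.encode.comp Computable.fst) Computable.snd)
  -- The machine halts on `S` and also on every `x` that collides with another string under `h c`,
  -- the reduction for its own code `c`.
  have hre : REPred fun y : Nat.Partrec.Code × List Bool =>
      y.2 ∈ S ∨ ∃ z, ¬ z = y.2 ∧ h y.1 z = h y.1 y.2 := by
    refine REPred.or (hS.comp Computable.snd) (REPred.exists
      (p := fun (y : Nat.Partrec.Code × List Bool) z => ¬ z = y.2 ∧ h y.1 z = h y.1 y.2)
      (REPred.and ?_ ?_))
    · exact PrimrecPred.to_re (PrimrecPred.not (Primrec.eq.comp Primrec.snd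
        (Primrec.snd.comp Primrec.fst)))
    · have h1 : REPred fun y : List Bool × List Bool => y.1 = y.2 :=
        (Primrec.eq (α := List Bool)).to_re
      let f : (Nat.Partrec.Code × List Bool) × List Bool → List Bool × List Bool :=
        fun y => (h y.1.1 y.2, h y.1.1 y.1.2)
      have hf : Computable f := (hh.comp (Computable.fst.comp Computable.fst) Computable.snd).pair
        (hh.comp (Computable.fst.comp Computable.fst) (Computable.snd.comp Computable.fst))
      exact REPred.comp h1 (f := f) hf
  obtain ⟨g, hg, hgS⟩ := REPred.exists_partial_snd
    (p := fun (c : Nat.Partrec.Code) x => x ∈ S ∨ ∃ z, ¬ z = x ∧ h c z = h c x) hre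
  -- The recursion theorem supplies a machine that uses its own code `c`, and so can inspect the
  -- reduction applied to itself.
  obtain ⟨c, hc⟩ := Nat.Partrec.Code.fixed_point₂
    (f := fun c n => ((Encodable.decode (α := List Bool) n : Option (List Bool)) :
      Part (List Bool)).bind fun x => (g c x).map Encodable.encode) (by
    refine Partrec.bind (Computable.ofOption (Computable.decode.comp Computable.snd)) ?_
    refine Partrec.map (hg.comp (Computable.fst.comp Computable.fst) Computable.snd) ?_
    exact (Computable.encode.comp Computable.snd).to₂)
  have hcode : ∀ x, codeFunction c x = g c x := fun x => by
    rw [codeFunction, hc]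
    simp [Part.bind_map, Part.bind_some_right]
  have hUh : ∀ x, U (h c x) = g c x := fun x => by
    rw [← hcode, ← universalMachine_withHeader, hred]
  -- Two colliding strings would both be accepted, each with itself as the output, although `U` has
  -- a single value at their common image.
  have hinj : Function.Injective (h c) := by
    intro x y hxy
    by_contra hne
    have hx := (hgS c x).1 (Or.inr ⟨y, fun e => hne e.symm, hxy.symm⟩)
    have hy := (hgS c y).1 (Or.inr ⟨x, hne, hxy⟩)
    rw [← hUh, hxy, hUh, hy] at hx
    exact hne (Part.some_injective hx).symm
  refine ⟨h c, hh.comp (Computable.const c) Computable.id, ⟨Encodable.encode c + 1 + c₀,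
    fun x => (hc₀ _).trans (by rw [length_withHeader]; omega)⟩, hinj, fun x => ?_⟩
  change (U (h c x)).Dom ↔ x ∈ S
  rw [hUh]
  by_cases hx : x ∈ S
  · simp [(hgS c x).1 (Or.inl hx), hx]
  · rw [(hgS c x).2 fun h => ?_]
    · simp [hx]
    · rcases h with h | ⟨z, hz, e⟩
      · exact hx h
      · exact hz (hinj e)

theorem eventually_ncard_le_mul {S : Set (List Bool)} (hS : Tendsto (fraction S) atTop (𝓝 0))
    {δ : ℝ} (hδ : 0 < δ) : ∀ᶠ n in atTop,
      ({x : List Bool | x.length ≤ n ∧ x ∈ S}.ncard : ℝ) ≤ δ * 2 ^ n := by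
  filter_upwards [hS.eventually (gt_mem_nhds (half_pos hδ))] with n hn
  rw [fraction, div_lt_iff₀ (fraction_denominator_pos n), pow_succ] at hn
  nlinarith

theorem eventually_const_le_mul (C : ℝ) {δ : ℝ} (hδ : 0 < δ) :
    ∀ᶠ n in atTop, C ≤ δ * 2 ^ n :=
  ((tendsto_pow_atTop_atTop_of_one_lt (by norm_num : (1 : ℝ) < 2)).const_mul_atTop
    hδ).eventually_ge_atTop C

/-- By injectivity, the strings of length at most `m` outside `S` have as many images among the
strings of length at most `m + c`. Almost surely an error-free algorithm answers only finitely many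
of these, so it misses a fraction of about `2 ^ (-c)`; the chosen `ε` is smaller by a factor that
absorbs `S` and the exceptions. -/
theorem IsEffectivelyOptimal.not_ioGenericallyProbComputable {U : List Bool →. List Bool}
    (hU : IsEffectivelyOptimal U) :
    ∃ ε : ℝ, 0 < ε ∧ ¬ IOGenericallyProbComputable (1 - ε) U.Dom := by
  obtain ⟨S, hSre, hSd, hS⟩ := exists_sparse_simple_set
  obtain ⟨h, hh, ⟨c, hc⟩, hinj, hA⟩ := hU.exists_injective_reduction hSre
  refine ⟨1 / 2 ^ (c + 2), by positivity,
    _root_.not_ioGenericallyProbComputable hS hh (Computable.const true) (fun x _ => hA x) ?_⟩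
  intro D hfin
  simp only [true_and] at hfin
  set F := {x | x ∉ S ∧ h x ∈ D}
  have h1 := eventually_ncard_le_mul hSd (show (0 : ℝ) < 1 / 8 by norm_num)
  have h2 := eventually_const_le_mul (F.ncard + 1) (show (0 : ℝ) < 1 / 8 by norm_num)
  obtain ⟨n₀, hn₀⟩ := eventually_atTop.1 (h1.and h2)
  filter_upwards [eventually_ge_atTop (n₀ + c)] with n hn
  obtain ⟨m, rfl⟩ : ∃ m, n = m + c := ⟨n - c, by omega⟩
  obtain ⟨h3, h4⟩ := hn₀ m (by omega)
  have h5 : {x : List Bool | x.length ≤ m ∧ x ∉ S}.ncard ≤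
      {x : List Bool | x.length ≤ m + c ∧ x ∉ D}.ncard + F.ncard := by
    have hsub : {x : List Bool | x.length ≤ m ∧ x ∉ S} ⊆
        h ⁻¹' {x : List Bool | x.length ≤ m + c ∧ x ∉ D} ∪ F := by
      rintro x ⟨hx, hxS⟩
      by_cases hxD : h x ∈ D
      · exact Or.inr ⟨hxS, hxD⟩
      · exact Or.inl ⟨(hc x).trans (by omega), hxD⟩
    have hpre : (h ⁻¹' {x : List Bool | x.length ≤ m + c ∧ x ∉ D}).Finite :=
      (finite_length_le_and Dᶜ _).preimage hinj.injOn
    refine (Set.ncard_le_ncard hsub (hpre.union hfin)).trans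
      ((Set.ncard_union_le _ _).trans (Nat.add_le_add_right ?_ _))
    rw [← Set.ncard_image_of_injective _ hinj]
    exact Set.ncard_le_ncard (Set.image_preimage_subset _ _) (finite_length_le_and Dᶜ _)
  have h6 := ncard_add_ncard_compl S m
  have h7 := ncard_add_ncard_compl D (m + c)
  have h8 : ({x : List Bool | x.length ≤ m ∧ x ∉ S}.ncard : ℝ) ≤
      {x : List Bool | x.length ≤ m + c ∧ x ∉ D}.ncard + F.ncard := by exact_mod_cast h5
  rw [fraction, div_lt_iff₀ (fraction_denominator_pos _)]
  have h9 : (1 : ℝ) / 2 ^ (c + 2) * (2 ^ (m + c + 1) - 1) ≤ 2 ^ m / 2 := by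
    have e : (2 : ℝ) ^ (m + c + 1) = 2 ^ m * 2 ^ c * 2 := by rw [pow_succ, pow_add]
    have e' : (2 : ℝ) ^ (c + 2) = 2 ^ c * 4 := by rw [pow_add]; norm_num
    rw [e, e', div_mul_eq_mul_div, div_le_iff₀ (by positivity)]
    have : (0 : ℝ) < 2 ^ c := by positivity
    nlinarith
  have h10 := two_pow_le_fraction_denominator m
  linarith

/-- A machine that behaves like the universal machine on inputs with prefix `1 ^ c`, and whose
domain coincides with `S` on the other inputs. -/
theorem exists_optimal_restricting_to {S : Set (List Bool)} (hS : REPred fun x => x ∈ S) (c : ℕ) :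
    ∃ U : List Bool →. List Bool, IsOptimal U ∧
      ∀ x, ¬ List.replicate c true <+: x → (x ∈ U.Dom ↔ x ∈ S) := by
  obtain ⟨g, hg, hgS⟩ := REPred.exists_partial_snd (p := fun (_ : Unit) x => x ∈ S)
    (hS.comp Computable.snd)
  classical
  have hdec : PrimrecPred fun x : List Bool => List.replicate c true <+: x :=
    PrimrecRel.list_prefix.comp (Primrec.const _) Primrec.id
  let U : List Bool →. List Bool := fun x =>
    bif decide (List.replicate c true <+: x) then universalMachine (x.drop c) else g () x
  refine ⟨U, isOptimal_universalMachine.of_reduction (c := c) ?_ fun p x hx => ?_, fun x hx => ?_⟩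
  · exact Partrec.cond hdec.decide.to_comp (partrec_universalMachine.comp
      (Primrec.list_drop.comp (Primrec.const c) Primrec.id).to_comp)
      (hg.comp (Computable.const ()) Computable.id)
  · refine ⟨List.replicate c true ++ p, ?_, by simp [add_comm]⟩
    simpa [U] using hx
  · change (U x).Dom ↔ x ∈ S
    by_cases hxS : x ∈ S
    · simp [U, hx, hxS, (hgS () x).1 hxS]
    · simp [U, hx, hxS, (hgS () x).2 hxS]

/-- Restricting the universal machine to the cone above `1 ^ c` costs only `c` bits. Elsewhere the
domain is `S`, so almost surely an error-free algorithm answers on nothing but the cone, part of `S`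
and finitely many other strings. -/
theorem exists_optimal_not_ioGenericallyProbComputable {r : ℝ} (hr : 0 < r) :
    ∃ U : List Bool →. List Bool, IsOptimal U ∧ ¬ IOGenericallyProbComputable r U.Dom := by
  classical
  obtain ⟨S, hSre, hSd, hS⟩ := exists_sparse_simple_set
  -- In units of `2 ^ n`, the cone takes at most `r / 4`, and `S` and the finite exceptions `r / 8`
  -- each, which stays below `r`.
  obtain ⟨c, hc⟩ := exists_pow_lt_of_lt_one (show 0 < r / 8 by positivity)
    (show (1 / 2 : ℝ) < 1 by norm_num)
  obtain ⟨U, hU, hUS⟩ := exists_optimal_restricting_to hSre c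
  have hdec : PrimrecPred fun x : List Bool => ¬ List.replicate c true <+: x :=
    (PrimrecRel.list_prefix.comp (Primrec.const _) Primrec.id).not
  refine ⟨U, hU, not_ioGenericallyProbComputable hS Computable.id
    (w := fun x => decide (¬ List.replicate c true <+: x)) hdec.decide.to_comp
    (fun x hx => hUS x (by simpa using hx)) ?_⟩
  intro D hfin
  simp only [decide_eq_true_eq, id_eq] at hfin
  set F := {x | ¬ List.replicate c true <+: x ∧ x ∉ S ∧ x ∈ D}
  have h1 := eventually_ncard_le_mul hSd (show (0 : ℝ) < r / 8 by positivity)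
  have h2 := eventually_const_le_mul F.ncard (show (0 : ℝ) < r / 8 by positivity)
  filter_upwards [h1, h2] with n h3 h4
  set P := {x : List Bool | List.replicate c true <+: x}
  have hP : ({x : List Bool | x.length ≤ n ∧ x ∈ P}.ncard : ℝ) ≤ r / 4 * 2 ^ n := by
    have h5 : {x : List Bool | x.length ≤ n ∧ x ∈ P}.ncard * 2 ^ c ≤ 2 ^ (n + 1) := by
      rw [ncard_length_le_and_eq_sum, Finset.sum_mul]
      refine (Finset.sum_le_sum (g := fun m => 2 ^ m) fun m _ => ?_).trans ?_
      · simpa [P] using ncard_prefix_le (List.replicate c true) m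
      · rw [Nat.geomSum_eq le_rfl]
        simp
    have h6 : ({x : List Bool | x.length ≤ n ∧ x ∈ P}.ncard : ℝ) * 2 ^ c ≤ 2 ^ (n + 1) := by
      exact_mod_cast h5
    rw [← le_div_iff₀ (by positivity)] at h6
    refine h6.trans ?_
    rw [one_div, inv_pow] at hc
    rw [pow_succ, div_eq_mul_inv]
    have : (0 : ℝ) < 2 ^ n := by positivity
    nlinarith
  have hsub : {x : List Bool | x.length ≤ n ∧ x ∈ D} ⊆
      ({x : List Bool | x.length ≤ n ∧ x ∈ P} ∪ {x : List Bool | x.length ≤ n ∧ x ∈ S}) ∪ F := by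
    rintro x ⟨hx, hxD⟩
    by_cases hxP : x ∈ P
    · exact Or.inl (Or.inl ⟨hx, hxP⟩)
    · by_cases hxS : x ∈ S
      · exact Or.inl (Or.inr ⟨hx, hxS⟩)
      · exact Or.inr ⟨hxP, hxS, hxD⟩
  have h5 : ({x : List Bool | x.length ≤ n ∧ x ∈ D}.ncard : ℝ) ≤
      {x : List Bool | x.length ≤ n ∧ x ∈ P}.ncard +
        {x : List Bool | x.length ≤ n ∧ x ∈ S}.ncard + F.ncard := by
    exact_mod_cast (Set.ncard_le_ncard hsub (((finite_length_le_and P n).union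
      (finite_length_le_and S n)).union hfin)).trans ((Set.ncard_union_le _ _).trans
        (Nat.add_le_add_right (Set.ncard_union_le _ _) _))
  rw [fraction, div_lt_iff₀ (fraction_denominator_pos _)]
  have h6 := two_pow_le_fraction_denominator n
  have h7 : (0 : ℝ) < 2 ^ n := by positivity
  have h8 := mul_le_mul_of_nonneg_left h6 hr.le
  have h9 := mul_pos hr h7
  linarith

theorem mainTheorem6 :
    -- no error-free randomized approximation has a domain of upper density one
    (∀ U : List Bool →. List Bool, IsOptimal U →
      ∀ Γ : RandomizedAlgorithm (List Bool) Bool,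
        coinMeasure {X | ErrorFree (Γ.run X) U.Dom ∧ upperDensity (Γ.run X).Dom = 1} = 0) ∧
    -- positive case: left-total optimal machines
    ((∃ U : List Bool →. List Bool, IsOptimal U ∧ LeftTotal U) ∧
      ∀ U : List Bool →. List Bool, IsOptimal U → LeftTotal U →
        ∀ ε : ℝ, 0 < ε → IOGenericallyProbComputable (1 - ε) U.Dom) ∧
    -- negative case: effectively optimal machines
    ((∃ U : List Bool →. List Bool, IsOptimal U ∧ IsEffectivelyOptimal U) ∧
      ∀ U : List Bool →. List Bool, IsEffectivelyOptimal U →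
        ∃ ε : ℝ, 0 < ε ∧ ¬ IOGenericallyProbComputable (1 - ε) U.Dom) ∧
    -- for each fixed threshold, the answer depends on the machine
    (∀ ε : ℝ, 0 < ε → ε < 1 →
      (∃ U : List Bool →. List Bool, IsOptimal U ∧
        IOGenericallyProbComputable (1 - ε) U.Dom) ∧
      (∃ U : List Bool →. List Bool, IsOptimal U ∧
        ¬ IOGenericallyProbComputable (1 - ε) U.Dom)) ∧
    -- the enumerable set of density zero
    (∃ S : Set (List Bool), REPred (fun x => x ∈ S) ∧
      Tendsto (fraction S) atTop (𝓝 0) ∧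
      ∀ Γ : RandomizedAlgorithm ℕ (List Bool),
        coinMeasure {X | (Γ.enumerated X).Infinite ∧ Γ.enumerated X ⊆ Sᶜ} = 0) := by
  refine ⟨fun U hU Γ => measure_errorFree_upperDensity_one hU Γ,
    ⟨exists_leftTotal_optimal, fun U hU hlt ε hε => hlt.ioGenericallyProbComputable hU.1 hε⟩,
    ⟨⟨universalMachine, isOptimal_universalMachine, isEffectivelyOptimal_universalMachine⟩,
      fun U hU => hU.not_ioGenericallyProbComputable⟩,
    fun ε h0 h1 => ⟨?_, exists_optimal_not_ioGenericallyProbComputable (sub_pos.2 h1)⟩,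
    exists_sparse_simple_set⟩
  obtain ⟨U, hU, hlt⟩ := exists_leftTotal_optimal
  exact ⟨U, hU, hlt.ioGenericallyProbComputable hU.1 h0⟩
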